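/- **Theorem 2 (label trace-relation, "Estimation of $L(z)$").** For every $K>0$ there are constants $C_K,\kappa_K$ depending only on $K$ such that the following holds. Let $N,M\ge 1$ with $M/N\le K$, put $\alpha_0=N/M$, let $\lambda>0$, let $S\in\mathbb R^{N\times M}$ satisfy $\|S\|_{\mathrm{op}}\le K$, let $Z\in\mathbb R^{N\times M}$ be a random matrix with i.i.d. centred Gaussian entries of variance $1/N$, and let $Y=\sqrt\lambda\,S+Z$. For $z\in\mathbb C\setminus\mathbb R$ define $$G(z)=\frac1N\operatorname{Tr}\,(z^2I-YY^{\mathsf T})^{-1},\qquad L(z)=\frac1N\operatorname{Tr}\,(z^2I-YY^{\mathsf T})^{-1}\,Y S^{\mathsf T}.$$ Then, for every $z\in\mathbb C\setminus\mathbb R$ with $|\operatorname{Im}z|<1$, $$L(z)=\frac1{\sqrt\lambda}\Big[G(z)\Big(z^2+1-\frac1{\alpha_0}\Big)-z^2G(z)^2-1\Big]+\epsilon_N,\qquad |\epsilon_N|\le\Big(1+\frac1{\sqrt\lambda}\Big)\frac{|C_K+X|}{N\,|\operatorname{Im}z|^3},$$ where $X$ is a complex random variable (depending on $N,M,\lambda,S,z$)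 that is sub-Gaussian with sub-Gaussian norm $\inf\{t>0:\mathbb E\,e^{|X|^2/t^2}\le 2\}$ at most $\kappa_K$. -/

import Mathlib

open MeasureTheory ProbabilityTheory
open scoped NNReal ENNReal

universe u

noncomputable section

/-- The spectral (Euclidean operator) norm of a real rectangular matrix. -/
def opNorm {N M : ℕ} (A : Matrix (Fin N) (Fin M) ℝ) : ℝ :=
  ‖LinearMap.toContinuousLinearMap (Matrix.toEuclideanLin A)‖

/-- A real matrix, viewed as a complex one. -/
def toComplex {N M : ℕ} (A : Matrix (Fin N) (Fin M) ℝ) : Matrix (Fin N) (Fin M) ℂ :=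
  A.map Complex.ofReal

/-- The observation `Y = √lam S + Z`. -/
def observation {N M : ℕ} (lam : ℝ) (S Z : Matrix (Fin N) (Fin M) ℝ) :
    Matrix (Fin N) (Fin M) ℝ :=
  Real.sqrt lam • S + Z

/-- The resolvent `(w I - Y Yᵀ)⁻¹` of `Y Yᵀ` at the complex number `w`. -/
def resolventYYT {N M : ℕ} (Y : Matrix (Fin N) (Fin M) ℝ) (w : ℂ) :
    Matrix (Fin N) (Fin N) ℂ :=
  (w • (1 : Matrix (Fin N) (Fin N) ℂ) - toComplex (Y * Y.transpose))⁻¹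

/-- `G(z) = (1/N) Tr (z² I - Y Yᵀ)⁻¹`. -/
def traceG {N M : ℕ} (Y : Matrix (Fin N) (Fin M) ℝ) (z : ℂ) : ℂ :=
  (1 / (N : ℂ)) * (resolventYYT Y (z ^ 2)).trace

/-- `L(z) = (1/N) Tr [(z² I - Y Yᵀ)⁻¹ Y Sᵀ]`. -/
def traceL {N M : ℕ} (Y S : Matrix (Fin N) (Fin M) ℝ) (z : ℂ) : ℂ :=
  (1 / (N : ℂ)) * (resolventYYT Y (z ^ 2) * toComplex Y * toComplex S.transpose).trace

/-- `Z` is a random `N × M` matrix with i.i.d. centred Gaussian entries of variance `1/N`. -/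
structure IsGaussianNoise {Ω : Type*} [MeasurableSpace Ω] (P : Measure Ω) {N M : ℕ}
    (Z : Ω → Matrix (Fin N) (Fin M) ℝ) : Prop where
  measurable_entry : ∀ i j, Measurable fun ω => Z ω i j
  law_entry : ∀ i j, P.map (fun ω => Z ω i j) = gaussianReal 0 (1 / (N : ℝ≥0))
  indep_entries : iIndepFun (fun (p : Fin N × Fin M) (ω : Ω) => Z ω p.1 p.2) P

/-- The sub-Gaussian (`ψ₂`) norm of a complex random variable,
`inf {t > 0 | 𝔼 exp (|X|² / t²) ≤ 2}`, which is `∞` if there is no such `t`. -/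
def subGaussianNorm {Ω : Type*} [MeasurableSpace Ω] (P : Measure Ω) (X : Ω → ℂ) : ℝ≥0∞ :=
  ⨅ (t : ℝ≥0) (_ : 0 < t)
    (_ : ∫⁻ ω, ENNReal.ofReal (Real.exp (‖X ω‖ ^ 2 / (t : ℝ) ^ 2)) ∂P ≤ 2), (t : ℝ≥0∞)

end

/-! Write `Y = √lam S + s x` with `s = N^(-1/2)` and `x` a standard Gaussian vector, and let `R` be
the resolvent at `z` of the Hermitian linearization of `Y`. Hermitian symmetry gives `‖R‖ ≤ |Im
z|⁻¹`, even where `z²` is real. Block identities for `R` (`blocks_inv_linearization`) turn the error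
exactly into `-D / (√lam N)`, where `D = s ∑ R_ij x_ij - s² Tr R₁₁ Tr R₂₂` (`traceL_sub_eq`). What
remains is probabilistic: `|Im z|³ |D|` must be sub-Gaussian uniformly in `N`.

Integration by parts suggests a bounded mean, because `∂R_ij/∂x_ij = s (R_ii R_jj + R_ij²)` and the
first product cancels the traces. Gaussian concentration would control the fluctuations, but the
available gradient bound for `D` contains a term of order `‖x‖ / N`. So `D` is first multiplied by a
smooth weight living at scale `‖x‖ ~ N`. The product has gradient
(`norm_fderiv_damping_mul_discrepancy_le`) and mean (`norm_integral_damping_mul_discrepancy_le`) of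
order `|Im z|⁻³`, free of `N`.

The weight is then removed (`exp_sq_norm_discrepancy_le`). Where `‖x‖² ≤ T N²` it is bounded below,
so the product controls `D`; elsewhere a bound linear in `‖x‖` is paid for by the chi-square tail.
`lintegral_exp_sq_norm_discrepancy_le` balances the constants. -/

/-! ### Gaussian exponential moments and Maurey–Pisier concentration. -/

section GaussianConcentration

/-- An upper bound on the exponential moment of the square of a standard Gaussian. -/
theorem integral_exp_mul_sq_gaussianReal_le {s : ℝ} (hs0 : 0 ≤ s) (hs : s ≤ 1 / 4) :
    Integrable (fun x : ℝ => Real.exp (s * x ^ 2)) (gaussianReal 0 1) ∧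
      ∫ x, Real.exp (s * x ^ 2) ∂(gaussianReal 0 1) ≤ Real.exp (2 * s) := by
  have hb : 0 < 1 / 2 - s := by linarith
  have hpdf : ∀ x : ℝ, gaussianPDFReal 0 1 x * Real.exp (s * x ^ 2)
      = (√(2 * Real.pi))⁻¹ * Real.exp (-(1 / 2 - s) * x ^ 2) := by
    intro x
    rw [gaussianPDFReal, mul_assoc, ← Real.exp_add]
    congr 2
    · simp
    · push_cast; ring
  constructor
  · rw [gaussianReal_of_var_ne_zero _ one_ne_zero, gaussianPDF_def]
    rw [integrable_withDensity_iff_integrable_smul' (by fun_prop) (by simp)]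
    refine ((integrable_exp_neg_mul_sq hb).const_mul (√(2 * Real.pi))⁻¹).congr
      (Filter.Eventually.of_forall fun x => ?_)
    simp only [smul_eq_mul]
    rw [ENNReal.toReal_ofReal (gaussianPDFReal_nonneg _ _ _), hpdf]
  · rw [integral_gaussianReal_eq_integral_smul one_ne_zero]
    simp only [smul_eq_mul, hpdf]
    rw [integral_const_mul, integral_gaussian, ← Real.sqrt_inv, ← Real.sqrt_mul (by positivity)]
    apply Real.sqrt_le_iff.2 ⟨by positivity, ?_⟩
    have h1 : (2 * Real.pi)⁻¹ * (Real.pi / (1 / 2 - s)) = 1 / (1 - 2 * s) := by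
      have : (1 - 2 * s) ≠ 0 := by linarith
      field_simp
    -- After squaring, the claim is `1 ≤ (1 - 2s) e^(4s)`. It follows from `e^(4s) ≥ 1 + 4s` and `(1
    -- - 2s)(1 + 4s) = 1 + 2s(1 - 4s)`, which needs `s ≤ 1/4`.
    rw [h1, div_le_iff₀ (by linarith), ← Real.exp_nat_mul]
    have := Real.add_one_le_exp ((2 : ℕ) * (2 * s))
    push_cast at this ⊢
    nlinarith

theorem lintegral_exp_mul_sq_gaussianReal_le {s : ℝ} (hs0 : 0 ≤ s) (hs : s ≤ 1 / 4) :
    ∫⁻ x, ENNReal.ofReal (Real.exp (s * x ^ 2)) ∂(gaussianReal 0 1)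
      ≤ ENNReal.ofReal (Real.exp (2 * s)) := by
  obtain ⟨hi, hle⟩ := integral_exp_mul_sq_gaussianReal_le hs0 hs
  rw [← ofReal_integral_eq_lintegral_ofReal hi (Filter.Eventually.of_forall fun _ => by positivity)]
  exact ENNReal.ofReal_le_ofReal hle

/-- The coordinates are independent, so the moment factors. This is the chi-square estimate for the
region where the weight is small. -/
theorem lintegral_exp_mul_norm_sq_stdGaussian_le {ι : Type*} [Fintype ι] {s : ℝ} (hs0 : 0 ≤ s)
    (hs : s ≤ 1 / 4) :
    ∫⁻ x, ENNReal.ofReal (Real.exp (s * ‖x‖ ^ 2)) ∂(stdGaussian (EuclideanSpace ℝ ι))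
      ≤ ENNReal.ofReal (Real.exp (2 * s * Fintype.card ι)) := by
  obtain ⟨hi, hle⟩ := integral_exp_mul_sq_gaussianReal_le hs0 hs
  rw [← map_pi_eq_stdGaussian, lintegral_map (by fun_prop) (by fun_prop)]
  have h : ∀ x : ι → ℝ, Real.exp (s * ‖WithLp.toLp 2 x‖ ^ 2)
      = ∏ i, Real.exp (s * x i ^ 2) := by
    intro x
    rw [EuclideanSpace.real_norm_sq_eq, Finset.mul_sum, Real.exp_sum]
  simp_rw [h]
  rw [← ofReal_integral_eq_lintegral_ofReal
    (Integrable.fintype_prod (f := fun _ x => Real.exp (s * x ^ 2)) fun _ => hi)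
    (Filter.Eventually.of_forall fun _ => by positivity)]
  rw [integral_fintype_prod_eq_pow (fun x => Real.exp (s * x ^ 2))]
  apply ENNReal.ofReal_le_ofReal
  calc _ ≤ (Real.exp (2 * s)) ^ Fintype.card ι := by
        gcongr
    _ = _ := by rw [← Real.exp_nat_mul]; ring_nf

variable {E : Type*} [NormedAddCommGroup E] [InnerProductSpace ℝ E] [FiniteDimensional ℝ E]
  [MeasurableSpace E] [BorelSpace E]

theorem map_dual_stdGaussian (l : StrongDual ℝ E) :
    (stdGaussian E).map l = (gaussianReal 0 1).map (‖l‖ * ·) := by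
  rw [IsGaussian.map_eq_gaussianReal, variance_dual_stdGaussian, integral_strongDual_stdGaussian,
    gaussianReal_map_const_mul]
  congr 1
  · simp
  · ext; simp

theorem lintegral_exp_mul_sq_dual_stdGaussian_le (l : StrongDual ℝ E) {c : ℝ} (hc : 0 ≤ c)
    (hcl : c * ‖l‖ ^ 2 ≤ 1 / 4) :
    ∫⁻ y, ENNReal.ofReal (Real.exp (c * l y ^ 2)) ∂(stdGaussian E) ≤ 2 := by
  have h1 : ∫⁻ y, ENNReal.ofReal (Real.exp (c * l y ^ 2)) ∂(stdGaussian E)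
      = ∫⁻ t, ENNReal.ofReal (Real.exp (c * t ^ 2)) ∂((stdGaussian E).map l) := by
    rw [lintegral_map (by fun_prop) (by fun_prop)]
  rw [h1, map_dual_stdGaussian, lintegral_map (by fun_prop) (by fun_prop)]
  simp_rw [mul_pow, ← mul_assoc]
  refine (lintegral_exp_mul_sq_gaussianReal_le (by positivity) hcl).trans ?_
  have : Real.exp (2 * (c * ‖l‖ ^ 2)) ≤ 2 := by
    calc _ ≤ Real.exp (1 / 2) := Real.exp_le_exp.2 (by linarith)
      _ ≤ 2 := by
        have h := Real.exp_one_lt_d9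
        have h2 : Real.exp (1 / 2) * Real.exp (1 / 2) = Real.exp 1 := by
          rw [← Real.exp_add]; norm_num
        nlinarith [Real.exp_pos (1 / 2)]
  simpa using ENNReal.ofReal_le_ofReal this

theorem convexOn_exp_mul_sq {c : ℝ} (hc : 0 ≤ c) :
    ConvexOn ℝ Set.univ (fun x : ℝ => Real.exp (c * x ^ 2)) := by
  refine ⟨convex_univ, fun x _ y _ a b ha hb hab => ?_⟩
  refine le_trans (Real.exp_le_exp.2 ?_)
    (convexOn_exp.2 (Set.mem_univ (c * x ^ 2)) (Set.mem_univ (c * y ^ 2)) ha hb hab)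
  obtain rfl : b = 1 - a := by linarith
  simp only [smul_eq_mul]
  have : 0 ≤ c * (a * (1 - a) * (x - y) ^ 2) := by positivity
  nlinarith

/-- The Maurey–Pisier rotation argument: Gaussian concentration for the difference of two
independent copies. -/
theorem lintegral_exp_sq_sub_stdGaussian_le {f : E → ℝ} (hf : ContDiff ℝ 1 f) {L c : ℝ}
    (hL : ∀ x, ‖fderiv ℝ f x‖ ≤ L) (hc : 0 ≤ c) (hcL : c * (Real.pi / 2) ^ 2 * L ^ 2 ≤ 1 / 4) :
    ∫⁻ p, ENNReal.ofReal (Real.exp (c * (f p.2 - f p.1) ^ 2))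
      ∂((stdGaussian E).prod (stdGaussian E)) ≤ 2 := by
  set γ := stdGaussian E
  set ν : Measure ℝ := volume.restrict (Set.Ioc 0 1)
  have hν : IsProbabilityMeasure ν := ⟨by simp [ν]⟩
  obtain ⟨rot, hrot'⟩ : ∃ rot : ℝ → E × E → E × E,
      ∀ t, rot t = ContinuousLinearMap.rotation (Real.pi / 2 * t) := ⟨_, fun _ => rfl⟩
  have hrot : ∀ t p, rot t p = (Real.cos (Real.pi / 2 * t) • p.1 + Real.sin (Real.pi / 2 * t) • p.2,
      -Real.sin (Real.pi / 2 * t) • p.1 + Real.cos (Real.pi / 2 * t) • p.2) := fun t p => by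
    rw [hrot']; rfl
  -- The first component of `rot t p` moves from `p.1` to `p.2`, with velocity `π/2` times the
  -- second component. Hence `g (rot t p)` is the derivative of `f` along this path.
  obtain ⟨g, hgdef⟩ : ∃ g : E × E → ℝ, ∀ p, g p = Real.pi / 2 * fderiv ℝ f p.1 p.2 :=
    ⟨_, fun _ => rfl⟩
  have hfd : Continuous (fderiv ℝ f) := hf.continuous_fderiv one_ne_zero
  have hg : Continuous g := by
    have := hfd.comp (continuous_fst (X := E) (Y := E))
    simp only [funext hgdef]
    exact continuous_const.mul (this.clm_apply continuous_snd)
  have hrotc : Continuous (fun q : ℝ × (E × E) => rot q.1 q.2) := by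
    simp only [hrot]
    fun_prop
  have hgrot : ∀ p, Continuous fun t => g (rot t p) := fun p =>
    hg.comp (hrotc.comp (continuous_id.prodMk continuous_const))
  have hderiv : ∀ p t, HasDerivAt (fun t => f (rot t p).1) (g (rot t p)) t := by
    intro p t
    have h1 : HasDerivAt (fun t => (rot t p).1) ((Real.pi / 2) • (rot t p).2) t := by
      simp only [hrot]
      have hlin : HasDerivAt (fun t : ℝ => Real.pi / 2 * t) (Real.pi / 2) t := by
        simpa using (hasDerivAt_id t).const_mul (Real.pi / 2)
      refine ((hlin.cos.smul_const p.1).add (hlin.sin.smul_const p.2)).congr_deriv ?_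
      module
    have h2 := ((hf.differentiable one_ne_zero) (rot t p).1).hasFDerivAt.comp_hasDerivAt t h1
    exact h2.congr_deriv (by simp [hgdef])
  have hftc : ∀ p : E × E, ∫ t, g (rot t p) ∂ν = f p.2 - f p.1 := by
    intro p
    have hc' := hgrot p
    have := intervalIntegral.integral_eq_sub_of_hasDerivAt (a := 0) (b := 1)
      (f := fun t => f (rot t p).1) (fun t _ => hderiv p t) (hc'.intervalIntegrable _ _)
    rw [intervalIntegral.integral_of_le zero_le_one] at this
    rw [this]
    simp [hrot]
  have hjensen : ∀ p : E × E, ENNReal.ofReal (Real.exp (c * (f p.2 - f p.1) ^ 2))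
      ≤ ∫⁻ t, ENNReal.ofReal (Real.exp (c * g (rot t p) ^ 2)) ∂ν := by
    intro p
    have hc' := hgrot p
    have hi : ∀ h : ℝ → ℝ, Continuous h → Integrable h ν := fun h hh =>
      (hh.integrableOn_Icc (a := 0) (b := 1)).mono_set Set.Ioc_subset_Icc_self
    have hi2 := hi (fun t => Real.exp (c * g (rot t p) ^ 2)) (by fun_prop)
    rw [← ofReal_integral_eq_lintegral_ofReal hi2
      (Filter.Eventually.of_forall fun _ => by positivity)]
    apply ENNReal.ofReal_le_ofReal
    have := (convexOn_exp_mul_sq hc).map_integral_le (μ := ν) (f := fun t => g (rot t p))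
      (by fun_prop) isClosed_univ (by simp) (hi _ hc') hi2
    rwa [hftc] at this
  have hmeas : Measurable fun p : E × E => ENNReal.ofReal (Real.exp (c * g p ^ 2)) := by
    have := hg.measurable
    fun_prop
  calc _ ≤ ∫⁻ p, ∫⁻ t, ENNReal.ofReal (Real.exp (c * g (rot t p) ^ 2)) ∂ν ∂(γ.prod γ) :=
        lintegral_mono hjensen
    _ = ∫⁻ t, ∫⁻ p, ENNReal.ofReal (Real.exp (c * g (rot t p) ^ 2)) ∂(γ.prod γ) ∂ν := by
        rw [lintegral_lintegral_swap]
        have h3 : Continuous fun q : (E × E) × ℝ => g (rot q.2 q.1) :=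
          hg.comp (hrotc.comp continuous_swap)
        have := h3.measurable
        exact Measurable.aemeasurable (by unfold Function.uncurry; fun_prop)
    -- `γ ⊗ γ` is rotation invariant, so the inner integral does not depend on `t`.
    _ = ∫⁻ t, ∫⁻ p, ENNReal.ofReal (Real.exp (c * g p ^ 2)) ∂(γ.prod γ) ∂ν := by
        congr 1
        ext t
        conv_rhs => rw [← IsGaussian.map_rotation_eq_self (μ := γ)
          (by simp [γ, id]) (Real.pi / 2 * t)]
        rw [lintegral_map hmeas (by fun_prop), hrot']
    _ = ∫⁻ p, ENNReal.ofReal (Real.exp (c * g p ^ 2)) ∂(γ.prod γ) := by simp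
    _ = ∫⁻ x, ∫⁻ y, ENNReal.ofReal (Real.exp (c * g (x, y) ^ 2)) ∂γ ∂γ :=
        lintegral_prod _ hmeas.aemeasurable
    -- For fixed `x`, `g (x, ·)` is a linear functional of norm at most `(π/2) L`, so only a
    -- one-dimensional Gaussian moment is needed.
    _ ≤ ∫⁻ _, 2 ∂γ := by
        refine lintegral_mono fun x => ?_
        have h4 := lintegral_exp_mul_sq_dual_stdGaussian_le (E := E) (fderiv ℝ f x)
          (c := c * (Real.pi / 2) ^ 2) (by positivity) ((by gcongr; exact hL x :
            c * (Real.pi / 2) ^ 2 * ‖fderiv ℝ f x‖ ^ 2 ≤ _).trans hcL)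
        simpa only [hgdef, mul_pow, mul_assoc] using h4
    _ = 2 := by simp

/-- Gaussian concentration with Gaussian tails for bounded smooth Lipschitz functions. -/
theorem lintegral_exp_sq_sub_integral_stdGaussian_le {f : E → ℝ} (hf : ContDiff ℝ 1 f) {L B c : ℝ}
    (hL : ∀ x, ‖fderiv ℝ f x‖ ≤ L) (hB : ∀ x, |f x| ≤ B) (hc : 0 ≤ c)
    (hcL : c * (Real.pi / 2) ^ 2 * L ^ 2 ≤ 1 / 4) :
    ∫⁻ y, ENNReal.ofReal (Real.exp (c * (f y - ∫ x, f x ∂(stdGaussian E)) ^ 2)) ∂(stdGaussian E)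
      ≤ 2 := by
  set γ := stdGaussian E
  have hfc := hf.continuous
  have hfi : Integrable f γ :=
    Integrable.of_bound hfc.aestronglyMeasurable B (Filter.Eventually.of_forall hB)
  -- Jensen in the first copy replaces `f p.1` by its mean. The bound `B` only provides
  -- integrability and leaves no trace in the estimate.
  refine le_trans ?_ (lintegral_exp_sq_sub_stdGaussian_le hf hL hc hcL)
  have hmeas : Measurable fun p : E × E =>
      ENNReal.ofReal (Real.exp (c * (f p.2 - f p.1) ^ 2)) := by
    have := hfc.measurable
    fun_prop
  rw [lintegral_prod_symm' _ hmeas]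
  refine lintegral_mono fun y => ?_
  have hi2 : Integrable (fun x => Real.exp (c * (f y - f x) ^ 2)) γ := by
    refine Integrable.of_bound (Continuous.aestronglyMeasurable (by fun_prop))
      (Real.exp (c * (2 * B) ^ 2)) (Filter.Eventually.of_forall fun x => ?_)
    rw [Real.norm_eq_abs, Real.abs_exp]
    have : |f y - f x| ≤ 2 * B := by
      have := abs_sub (f y) (f x)
      linarith [hB y, hB x]
    apply Real.exp_le_exp.2
    apply mul_le_mul_of_nonneg_left _ hc
    nlinarith [sq_abs (f y - f x), abs_nonneg (f y - f x)]
  rw [← ofReal_integral_eq_lintegral_ofReal hi2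
      (Filter.Eventually.of_forall fun _ => by positivity)]
  apply ENNReal.ofReal_le_ofReal
  have := (convexOn_exp_mul_sq hc).map_integral_le (μ := γ) (f := fun x => f y - f x)
      (by fun_prop) isClosed_univ (by simp) ((integrable_const _).sub hfi) hi2
  rwa [integral_sub (integrable_const _) hfi, integral_const, probReal_univ, one_smul] at this

/-! ### Gaussian integration by parts. -/

/-- This is the identity covariance of the standard Gaussian, tested against each `v`. -/
theorem integral_inner_smul_self_stdGaussian (e : E) :
    ∫ y, inner ℝ y e • y ∂(stdGaussian E) = e := by
  have h2 : MemLp (id : E → E) 2 (stdGaussian E) := IsGaussian.memLp_two_id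
  have hi : Integrable (fun y : E => inner ℝ y e • y) (stdGaussian E) := by
    have h3 : MemLp (fun y : E => inner ℝ y e) 2 (stdGaussian E) := h2.inner_const e
    have h4 : MemLp (fun y : E => inner ℝ y e • y) 1 (stdGaussian E) :=
      MemLp.smul (p := 2) (q := 2) h2 h3
    exact memLp_one_iff_integrable.1 h4
  refine ext_inner_left ℝ fun v => ?_
  rw [← integral_inner hi v]
  have h := covarianceBilin_apply (μ := stdGaussian E) h2 e v
  rw [covarianceBilin_stdGaussian] at h
  simp only [id, integral_id_stdGaussian, sub_zero] at h
  have h' : inner ℝ e v = ∫ z, inner ℝ e z * inner ℝ v z ∂stdGaussian E := h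
  rw [real_inner_comm e v, h']
  simp_rw [inner_smul_right, real_inner_comm]

variable {F : Type*} [NormedAddCommGroup F] [NormedSpace ℝ F] [CompleteSpace F]

/-- Gaussian integration by parts. -/
theorem integral_inner_smul_stdGaussian {h : E → F} (hh : ContDiff ℝ 1 h) {B B' : ℝ}
    (hB : ∀ x, ‖h x‖ ≤ B) (hB' : ∀ x, ‖fderiv ℝ h x‖ ≤ B') (e : E) :
    ∫ x, inner ℝ x e • h x ∂(stdGaussian E) = ∫ x, fderiv ℝ h x e ∂(stdGaussian E) := by
  set γ := stdGaussian E
  have hh0 := hh.continuous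
  have hfd : Continuous (fderiv ℝ h) := hh.continuous_fderiv one_ne_zero
  have hB'0 : 0 ≤ B' := (norm_nonneg _).trans (hB' 0)
  have hL2 : MemLp (id : E → E) 2 γ := IsGaussian.memLp_two_id
  have hL1 : Integrable (fun y : E => ‖y‖) γ := (IsGaussian.integrable_id (μ := γ)).norm
  have hsq : Integrable (fun y : E => ‖y‖ ^ 2) γ := hL2.integrable_norm_pow two_ne_zero
  have hinn : Integrable (fun y : E => inner ℝ y e) γ :=
    (IsGaussian.integrable_id (μ := γ)).inner_const e
  have hinn0 : ∫ y : E, inner ℝ y e ∂γ = 0 := by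
    have := integral_strongDual_stdGaussian (innerSL ℝ e)
    simpa [real_inner_comm, γ] using this
  -- The same rotated integral is differentiated at `θ = 0` in two ways. Rotation invariance
  -- evaluates it as `sin θ` times the left side of the theorem, the `cos θ` term vanishing because
  -- the second copy is centred; differentiating under the integral gives the right side.
  have hsin : ∀ θ : ℝ, ∫ p : E × E, inner ℝ p.2 e • h (Real.cos θ • p.1 + Real.sin θ • p.2)
      ∂(γ.prod γ) = Real.sin θ • ∫ x, inner ℝ x e • h x ∂γ := by
    intro θ
    let Ψ : E × E → F := fun p => inner ℝ (Real.sin θ • p.1 + Real.cos θ • p.2) e • h p.1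
    have hΨc : Continuous Ψ := by fun_prop
    have hΨ : ∀ p, Ψ (ContinuousLinearMap.rotation θ p)
        = inner ℝ p.2 e • h (Real.cos θ • p.1 + Real.sin θ • p.2) := by
      intro p
      simp only [Ψ, ContinuousLinearMap.rotation_apply]
      congr 2
      have := Real.sin_sq_add_cos_sq θ
      calc _ = (Real.sin θ ^ 2 + Real.cos θ ^ 2) • p.2 := by module
        _ = p.2 := by rw [this, one_smul]
    have hΨi : Integrable Ψ (γ.prod γ) := by
      have hbd : Integrable (fun p : E × E => (‖p.1‖ + ‖p.2‖) * (‖e‖ * B)) (γ.prod γ) :=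
        ((hL1.comp_fst γ).add (hL1.comp_snd γ)).mul_const _
      refine hbd.mono' hΨc.aestronglyMeasurable (Filter.Eventually.of_forall fun p => ?_)
      simp only [Ψ]
      rw [norm_smul, ← mul_assoc]
      gcongr
      · refine (norm_inner_le_norm _ _).trans ?_
        gcongr
        refine (norm_add_le _ _).trans ?_
        rw [norm_smul, norm_smul]
        have h1 := Real.abs_sin_le_one θ
        have h2 := Real.abs_cos_le_one θ
        simp only [Real.norm_eq_abs]
        nlinarith [norm_nonneg p.1, norm_nonneg p.2]
      · exact hB _
    calc _ = ∫ p, Ψ (ContinuousLinearMap.rotation θ p) ∂(γ.prod γ) := by simp_rw [hΨ]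
      _ = ∫ p, Ψ p ∂(γ.prod γ) := by
        conv_rhs => rw [← IsGaussian.map_rotation_eq_self (μ := γ) (by simp [γ, id]) θ]
        rw [integral_map (by fun_prop) hΨc.aestronglyMeasurable]
      _ = ∫ x, ∫ y, Ψ (x, y) ∂γ ∂γ := integral_prod _ hΨi
      _ = ∫ x, Real.sin θ • (inner ℝ x e • h x) ∂γ := by
        congr 1
        ext x
        simp only [Ψ, inner_add_left, inner_smul_left, conj_trivial]
        rw [integral_smul_const, integral_add (integrable_const _) (hinn.const_mul _),
          integral_const_mul (Real.cos θ), hinn0]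
        simp [smul_smul]
      _ = _ := integral_smul _ _
  have hder : HasDerivAt (fun θ : ℝ => ∫ p : E × E,
      inner ℝ p.2 e • h (Real.cos θ • p.1 + Real.sin θ • p.2) ∂(γ.prod γ))
      (∫ p : E × E, inner ℝ p.2 e • fderiv ℝ h (Real.cos 0 • p.1 + Real.sin 0 • p.2)
        (-Real.sin 0 • p.1 + Real.cos 0 • p.2) ∂(γ.prod γ)) 0 := by
    refine (hasDerivAt_integral_of_dominated_loc_of_deriv_le
      (F' := fun θ (p : E × E) => inner ℝ p.2 e • fderiv ℝ h (Real.cos θ • p.1 + Real.sin θ • p.2)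
        (-Real.sin θ • p.1 + Real.cos θ • p.2))
      (bound := fun p : E × E => ‖e‖ * B' * (‖p.1‖ * ‖p.2‖ + ‖p.2‖ ^ 2))
      (s := Set.univ) Filter.univ_mem (Filter.Eventually.of_forall fun θ => ?_) ?_ ?_
      (Filter.Eventually.of_forall fun p θ _ => ?_) ?_
      (Filter.Eventually.of_forall fun p θ _ => ?_)).2
    · exact Continuous.aestronglyMeasurable (by fun_prop)
    · have hbd : Integrable (fun p : E × E => ‖p.2‖ * (‖e‖ * B)) (γ.prod γ) :=
        (hL1.comp_snd γ).mul_const _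
      refine hbd.mono' (Continuous.aestronglyMeasurable (by fun_prop))
        (Filter.Eventually.of_forall fun p => ?_)
      rw [norm_smul, ← mul_assoc]
      gcongr
      · exact norm_inner_le_norm _ _
      · exact hB _
    · refine Continuous.aestronglyMeasurable ?_
      have hc1 : Continuous fun p : E × E => Real.cos 0 • p.1 + Real.sin 0 • p.2 := by fun_prop
      have hc2 : Continuous fun p : E × E => -Real.sin 0 • p.1 + Real.cos 0 • p.2 := by fun_prop
      exact (continuous_snd.inner continuous_const).smul ((hfd.comp hc1).clm_apply hc2)
    · rw [norm_smul]
      have h1 : ‖-Real.sin θ • p.1 + Real.cos θ • p.2‖ ≤ ‖p.1‖ + ‖p.2‖ := by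
        refine (norm_add_le _ _).trans ?_
        rw [norm_smul, norm_smul, norm_neg]
        have h1 := Real.abs_sin_le_one θ
        have h2 := Real.abs_cos_le_one θ
        simp only [Real.norm_eq_abs]
        nlinarith [norm_nonneg p.1, norm_nonneg p.2]
      calc _ ≤ (‖p.2‖ * ‖e‖) * (B' * (‖p.1‖ + ‖p.2‖)) := by
            gcongr
            · exact norm_inner_le_norm _ _
            · exact (ContinuousLinearMap.le_opNorm _ _).trans (by gcongr; exact hB' _)
        _ = _ := by ring
    · have h1 := hL1.mul_prod hL1
      exact (h1.add (hsq.comp_snd γ)).const_mul _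
    · have h1 : HasDerivAt (fun θ : ℝ => Real.cos θ • p.1 + Real.sin θ • p.2)
          (-Real.sin θ • p.1 + Real.cos θ • p.2) θ :=
        ((Real.hasDerivAt_cos θ).smul_const p.1).add ((Real.hasDerivAt_sin θ).smul_const p.2)
      exact (((hh.differentiable one_ne_zero) _).hasFDerivAt.comp_hasDerivAt θ h1).const_smul _
  have hder2 : HasDerivAt (fun θ : ℝ => ∫ p : E × E,
      inner ℝ p.2 e • h (Real.cos θ • p.1 + Real.sin θ • p.2) ∂(γ.prod γ))
      (∫ x, inner ℝ x e • h x ∂γ) 0 := by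
    simp_rw [hsin]
    have := (Real.hasDerivAt_sin 0).smul_const (∫ x, inner ℝ x e • h x ∂γ)
    simpa using this
  rw [hder2.unique hder]
  simp only [Real.cos_zero, Real.sin_zero, one_smul, zero_smul, add_zero, neg_zero, zero_add]
  have hint : Integrable (fun p : E × E => inner ℝ p.2 e • fderiv ℝ h p.1 p.2) (γ.prod γ) := by
    have hbd : Integrable (fun p : E × E => ‖e‖ * B' * ‖p.2‖ ^ 2) (γ.prod γ) :=
      (hsq.comp_snd γ).const_mul _
    refine hbd.mono' (Continuous.aestronglyMeasurable ?_) (Filter.Eventually.of_forall fun p => ?_)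
    · exact (continuous_snd.inner continuous_const).smul
        ((hfd.comp continuous_fst).clm_apply continuous_snd)
    · rw [norm_smul]
      calc _ ≤ (‖p.2‖ * ‖e‖) * (B' * ‖p.2‖) := by
            gcongr
            · exact norm_inner_le_norm _ _
            · exact (ContinuousLinearMap.le_opNorm _ _).trans (by gcongr; exact hB' _)
        _ = _ := by ring
  rw [integral_prod _ hint]
  congr 1
  ext x
  have hi : Integrable (fun y : E => inner ℝ y e • y) γ :=
    memLp_one_iff_integrable.1 (MemLp.smul (p := 2) (q := 2) hL2 (hL2.inner_const e))
  -- Integrating out the second copy, `∫ ⟪y, e⟫ y = e` passes through the linear map `fderiv ℝ h x`.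
  have := (fderiv ℝ h x).integral_comp_comm hi
  simp only [map_smul] at this
  rw [this, integral_inner_smul_self_stdGaussian]

end GaussianConcentration

/-! ### Hilbert–Schmidt and operator norms; the resolvent of a Hermitian matrix. -/

section MatrixNorms

open scoped Matrix.Norms.L2Operator

variable {m n : Type*} [Fintype m] [Fintype n]

/-- The Hilbert–Schmidt norm of a complex matrix. -/
noncomputable def hsNorm (A : Matrix m n ℂ) : ℝ := √(∑ i, ∑ j, ‖A i j‖ ^ 2)

theorem hsNorm_nonneg (A : Matrix m n ℂ) : 0 ≤ hsNorm A := Real.sqrt_nonneg _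

theorem hsNorm_sq (A : Matrix m n ℂ) : hsNorm A ^ 2 = ∑ i, ∑ j, ‖A i j‖ ^ 2 :=
  Real.sq_sqrt (by positivity)

theorem hsNorm_conjTranspose (A : Matrix m n ℂ) : hsNorm A.conjTranspose = hsNorm A := by
  unfold hsNorm
  rw [Finset.sum_comm]
  simp

theorem norm_entry_le_hsNorm (A : Matrix m n ℂ) (i : m) (j : n) : ‖A i j‖ ≤ hsNorm A := by
  refine (pow_le_pow_iff_left₀ (norm_nonneg _) (hsNorm_nonneg _) two_ne_zero).1 ?_
  rw [hsNorm_sq]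
  exact (Finset.single_le_sum (f := fun j => ‖A i j‖ ^ 2) (fun _ _ => by positivity)
    (Finset.mem_univ j)).trans (Finset.single_le_sum (f := fun i => ∑ j, ‖A i j‖ ^ 2)
      (fun _ _ => by positivity) (Finset.mem_univ i))

variable [DecidableEq n]

/-- The operator norm bound is applied to each column of `B` and the squares are summed. -/
theorem hsNorm_mul_le_left (A : Matrix n n ℂ) (B : Matrix n m ℂ) :
    hsNorm (A * B) ≤ ‖A‖ * hsNorm B := by
  refine (pow_le_pow_iff_left₀ (hsNorm_nonneg _)
    (mul_nonneg (norm_nonneg _) (hsNorm_nonneg _)) two_ne_zero).1 ?_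
  rw [mul_pow, hsNorm_sq, hsNorm_sq, Finset.sum_comm, Finset.sum_comm (f := fun i j => ‖B i j‖ ^ 2),
    Finset.mul_sum]
  refine Finset.sum_le_sum fun j _ => ?_
  have h := A.l2_opNorm_mulVec (WithLp.toLp 2 (fun i => B i j))
  have h2 := pow_le_pow_left₀ (norm_nonneg _) h 2
  rw [mul_pow, EuclideanSpace.norm_sq_eq, EuclideanSpace.norm_sq_eq] at h2
  simpa [Matrix.mulVec, dotProduct, Matrix.mul_apply] using h2

theorem hsNorm_mul_le_right (A B : Matrix n n ℂ) : hsNorm (A * B) ≤ hsNorm A * ‖B‖ := by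
  rw [← hsNorm_conjTranspose, Matrix.conjTranspose_mul, mul_comm (hsNorm A),
    ← hsNorm_conjTranspose A, ← Matrix.l2_opNorm_conjTranspose B]
  exact hsNorm_mul_le_left _ _

theorem hsNorm_mul_mul_le (A B C : Matrix n n ℂ) : hsNorm (A * B * C) ≤ ‖A‖ * hsNorm B * ‖C‖ :=
  (hsNorm_mul_le_right _ _).trans
    (mul_le_mul_of_nonneg_right (hsNorm_mul_le_left _ _) (norm_nonneg _))

/-- Up to conjugation, row `i` of `A` is the adjoint applied to a unit basis vector. -/
theorem sum_norm_sq_row_le (A : Matrix n n ℂ) (i : n) : ∑ j, ‖A i j‖ ^ 2 ≤ ‖A‖ ^ 2 := by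
  have h := A.conjTranspose.l2_opNorm_mulVec (EuclideanSpace.single i 1)
  have h2 := pow_le_pow_left₀ (norm_nonneg _) h 2
  rw [mul_pow, EuclideanSpace.norm_sq_eq, Matrix.l2_opNorm_conjTranspose] at h2
  simpa using h2

theorem norm_entry_le (A : Matrix n n ℂ) (i j : n) : ‖A i j‖ ≤ ‖A‖ := by
  refine (pow_le_pow_iff_left₀ (norm_nonneg _) (norm_nonneg _) two_ne_zero).1 ?_
  exact (Finset.single_le_sum (f := fun j => ‖A i j‖ ^ 2) (fun _ _ => by positivity)
    (Finset.mem_univ j)).trans (sum_norm_sq_row_le A i)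

/-- Since `⟪v, H v⟫` is real, `Im ⟪v, (z - H) v⟫ = Im z ‖v‖²`, and Cauchy–Schwarz concludes.
Invertibility of `z - H` and the resolvent bound both come from this. -/
theorem Matrix.IsHermitian.norm_le_norm_sub_mulVec {H : Matrix n n ℂ} (hH : H.IsHermitian) (z : ℂ)
    (v : EuclideanSpace ℂ n) :
    |z.im| * ‖v‖ ≤ ‖Matrix.toEuclideanCLM (𝕜 := ℂ) (z • 1 - H) v‖ := by
  rcases eq_or_ne v 0 with rfl | hv
  · simp
  have hsa : IsSelfAdjoint (Matrix.toEuclideanCLM (𝕜 := ℂ) H) := by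
    rw [IsSelfAdjoint, ← map_star]
    exact congrArg _ hH
  have him : (inner ℂ v (Matrix.toEuclideanCLM (𝕜 := ℂ) H v)).im = 0 := by
    have := hsa.isSymmetric v v
    have h2 := inner_conj_symm (𝕜 := ℂ) v (Matrix.toEuclideanCLM (𝕜 := ℂ) H v)
    rw [← Complex.conj_eq_iff_im, inner_conj_symm]
    exact this
  have h1 : (inner ℂ v (Matrix.toEuclideanCLM (𝕜 := ℂ) (z • 1 - H) v)).im = z.im * ‖v‖ ^ 2 := by
    have h0 : Matrix.toEuclideanCLM (𝕜 := ℂ) (z • 1 - H) v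
        = z • v - Matrix.toEuclideanCLM (𝕜 := ℂ) H v := by
      rw [map_sub, map_smul, map_one]
      rfl
    rw [h0, inner_sub_right, inner_smul_right, Complex.sub_im, him,
      inner_self_eq_norm_sq_to_K]
    simp [← Complex.ofReal_pow]
  have h2 := (Complex.abs_im_le_norm _).trans
    (norm_inner_le_norm (𝕜 := ℂ) v (Matrix.toEuclideanCLM (𝕜 := ℂ) (z • 1 - H) v))
  rw [h1, abs_mul, abs_of_nonneg (sq_nonneg ‖v‖)] at h2
  have hv' : 0 < ‖v‖ := norm_pos_iff.2 hv
  nlinarith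

theorem Matrix.IsHermitian.isUnit_smul_one_sub {H : Matrix n n ℂ} (hH : H.IsHermitian) {z : ℂ}
    (hz : z.im ≠ 0) : IsUnit (z • 1 - H) := by
  rw [← Matrix.mulVec_injective_iff_isUnit]
  refine (injective_iff_map_eq_zero (Matrix.mulVecLin (z • 1 - H))).2 fun v hv => ?_
  have h := hH.norm_le_norm_sub_mulVec z (WithLp.toLp 2 v)
  rw [Matrix.toEuclideanCLM_toLp] at h
  rw [Matrix.mulVecLin_apply] at hv
  rw [hv] at h
  have h0 : ‖WithLp.toLp 2 v‖ ≤ 0 := by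
    have := abs_pos.2 hz
    simp only [WithLp.toLp_zero, norm_zero] at h
    nlinarith [norm_nonneg (WithLp.toLp 2 v)]
  simpa using norm_le_zero_iff.1 h0

theorem Matrix.IsHermitian.norm_inv_smul_one_sub_le {H : Matrix n n ℂ} (hH : H.IsHermitian) {z : ℂ}
    (hz : z.im ≠ 0) : ‖(z • 1 - H)⁻¹‖ ≤ |z.im|⁻¹ := by
  have hpos := abs_pos.2 hz
  rw [← Matrix.l2_opNorm_toEuclideanCLM]
  refine ContinuousLinearMap.opNorm_le_bound _ (by positivity) fun v => ?_
  have h := hH.norm_le_norm_sub_mulVec z (Matrix.toEuclideanCLM (𝕜 := ℂ) (z • 1 - H)⁻¹ v)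
  have hinv : Matrix.toEuclideanCLM (𝕜 := ℂ) (z • 1 - H)
      (Matrix.toEuclideanCLM (𝕜 := ℂ) (z • 1 - H)⁻¹ v) = v := by
    rw [← mul_apply_eq_comp, ← map_mul, Matrix.mul_nonsing_inv _
      ((Matrix.isUnit_iff_isUnit_det _).1 (hH.isUnit_smul_one_sub hz)), map_one]
    rfl
  rw [hinv] at h
  rwa [inv_mul_eq_div, le_div_iff₀ hpos, mul_comm]

end MatrixNorms

/-! ### Differentiating the entries of a matrix inverse. -/

section MatrixCalculus

variable {n : Type*} [Fintype n] [DecidableEq n]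
  {E : Type*} [NormedAddCommGroup E] [NormedSpace ℝ E]

theorem contDiff_det {M : E → Matrix n n ℂ} (hM : ∀ i j, ContDiff ℝ 1 fun x => M x i j) :
    ContDiff ℝ 1 fun x => (M x).det := by
  simp only [Matrix.det_apply']
  exact ContDiff.sum fun σ _ => contDiff_const.mul (contDiff_prod fun i _ => hM _ _)

/-- By Cramer's rule, entries of the inverse are cofactors divided by a nonvanishing determinant. -/
theorem contDiff_inv_entry {M : E → Matrix n n ℂ} (hM : ∀ i j, ContDiff ℝ 1 fun x => M x i j)
    (hu : ∀ x, IsUnit (M x)) (i j : n) : ContDiff ℝ 1 fun x => (M x)⁻¹ i j := by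
  have hdet : ∀ x, (M x).det ≠ 0 := fun x => ((Matrix.isUnit_iff_isUnit_det _).1 (hu x)).ne_zero
  simp only [Matrix.inv_def, Matrix.smul_apply, Ring.inverse_eq_inv', smul_eq_mul,
    Matrix.adjugate_apply]
  refine ((contDiff_det hM).inv hdet).mul (contDiff_det fun k l => ?_)
  by_cases h : k = j
  · subst h
    simpa using contDiff_const
  · simpa [Matrix.updateRow_ne h] using hM k l

/-- Obtained by differentiating `M M⁻¹ = 1` entry by entry. -/
theorem fderiv_inv_entry {M : E → Matrix n n ℂ} (hM : ∀ i j, ContDiff ℝ 1 fun x => M x i j)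
    (hu : ∀ x, IsUnit (M x)) (x v : E) (i j : n) :
    fderiv ℝ (fun x => (M x)⁻¹ i j) x v
      = -((M x)⁻¹ * (Matrix.of fun k l => fderiv ℝ (fun x => M x k l) x v) * (M x)⁻¹) i j := by
  have hdet : ∀ x, IsUnit (M x).det := fun x => (Matrix.isUnit_iff_isUnit_det _).1 (hu x)
  set dM : Matrix n n ℂ := Matrix.of fun k l => fderiv ℝ (fun x => M x k l) x v with hdM
  set dR : Matrix n n ℂ := Matrix.of fun k l => fderiv ℝ (fun x => (M x)⁻¹ k l) x v with hdR
  have hd1 : ∀ k l, DifferentiableAt ℝ (fun x => M x k l) x := fun k l =>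
    (hM k l).differentiable one_ne_zero x
  have hd2 : ∀ k l, DifferentiableAt ℝ (fun x => (M x)⁻¹ k l) x := fun k l =>
    (contDiff_inv_entry hM hu k l).differentiable one_ne_zero x
  have key : M x * dR + dM * (M x)⁻¹ = 0 := by
    ext k l
    have h1 : (fun x => ∑ r, M x k r * (M x)⁻¹ r l) = fun _ => (1 : Matrix n n ℂ) k l := by
      ext y
      rw [← Matrix.mul_apply, Matrix.mul_nonsing_inv _ (hdet y)]
    have h2 := congrArg (fun f => fderiv ℝ f x v) h1
    simp only [fderiv_fun_const, Pi.zero_apply, zero_apply] at h2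
    rw [fderiv_fun_sum fun r _ => (hd1 k r).fun_mul (hd2 r l)] at h2
    simp only [sum_apply] at h2
    rw [Matrix.zero_apply, Matrix.add_apply, Matrix.mul_apply, Matrix.mul_apply,
      ← Finset.sum_add_distrib]
    convert h2 using 2 with r
    rw [fderiv_fun_mul (hd1 k r) (hd2 r l)]
    simp [hdM, hdR, mul_comm]
  have : dR = -((M x)⁻¹ * dM * (M x)⁻¹) := by
    have h3 := congrArg (fun A => (M x)⁻¹ * A) key
    simp only [mul_add, mul_zero, ← mul_assoc, Matrix.nonsing_inv_mul _ (hdet x), one_mul] at h3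
    exact eq_neg_of_add_eq_zero_left h3
  have h4 := congrFun (congrFun this i) j
  simpa [hdR] using h4

end MatrixCalculus

/-! ### The normalisation `s = N^(-1/2)`, encoded as `s² N = 1`. -/

section Scaling

theorem pos_of_sq_mul_eq_one {s N : ℝ} (hN : 0 ≤ N) (h : s ^ 2 * N = 1) : 0 < N :=
  hN.lt_of_ne fun h0 => by simp [← h0] at h

theorem mul_sqrt_eq_one {s N : ℝ} (hs : 0 ≤ s) (h : s ^ 2 * N = 1) : s * √N = 1 := by
  rw [← Real.sqrt_sq hs, ← Real.sqrt_mul (sq_nonneg s), h, Real.sqrt_one]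

end Scaling

/-! ### The linearized resolvent and the discrepancy: size and gradient. -/

section Linearization

open scoped Matrix.Norms.L2Operator

variable {p q : Type*}

/-- The Hermitian linearization of a rectangular real matrix. -/
def linearization (Y : Matrix p q ℝ) : Matrix (p ⊕ q) (p ⊕ q) ℂ :=
  Matrix.fromBlocks 0 (Y.map Complex.ofReal) (Y.transpose.map Complex.ofReal) 0

/-- The matrix with entries `s x_{ij}`. -/
def scaledMatrix (s : ℝ) (x : EuclideanSpace ℝ (p × q)) : Matrix p q ℝ :=
  Matrix.of fun i j => s * x (i, j)

theorem isHermitian_linearization (Y : Matrix p q ℝ) : (linearization Y).IsHermitian := by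
  rw [linearization, Matrix.isHermitian_fromBlocks_iff]
  refine ⟨Matrix.isHermitian_zero, ?_, ?_, Matrix.isHermitian_zero⟩ <;>
  · ext i j
    simp

variable [Fintype p] [Fintype q]

/-- The entries of `linearization (scaledMatrix s x)` as continuous linear functions of `x`. -/
noncomputable def linearizationEntry (s : ℝ) (a b : p ⊕ q) :
    EuclideanSpace ℝ (p × q) →L[ℝ] ℂ :=
  LinearMap.toContinuousLinearMap
    { toFun := fun x => linearization (scaledMatrix s x) a b
      map_add' := fun x y => by
        rcases a with a | a <;> rcases b with b | b <;>
          simp [linearization, scaledMatrix, mul_add]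
      map_smul' := fun c x => by
        rcases a with a | a <;> rcases b with b | b <;>
          simp [linearization, scaledMatrix, mul_left_comm] }

theorem linearizationEntry_apply (s : ℝ) (a b : p ⊕ q) (x : EuclideanSpace ℝ (p × q)) :
    linearizationEntry s a b x = linearization (scaledMatrix s x) a b := rfl

/-- Each entry occurs twice, so the exact value is `√2 s ‖v‖`; the factor `2` avoids the root. -/
theorem hsNorm_linearization_scaledMatrix_le {s : ℝ} (hs : 0 ≤ s) (v : EuclideanSpace ℝ (p × q)) :
    hsNorm (linearization (scaledMatrix s v)) ≤ 2 * s * ‖v‖ := by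
  refine (pow_le_pow_iff_left₀ (hsNorm_nonneg _) (by positivity) two_ne_zero).1 ?_
  have h : ∑ i : p, ∑ j : q, (s * v (i, j)) ^ 2 = s ^ 2 * ‖v‖ ^ 2 := by
    rw [EuclideanSpace.real_norm_sq_eq, Fintype.sum_prod_type, Finset.mul_sum]
    refine Finset.sum_congr rfl fun i _ => ?_
    rw [Finset.mul_sum]
    exact Finset.sum_congr rfl fun j _ => by ring
  have h' : ∑ j : q, ∑ i : p, (s * v (i, j)) ^ 2 = s ^ 2 * ‖v‖ ^ 2 := by
    rw [Finset.sum_comm, h]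
  rw [hsNorm_sq]
  simp only [Fintype.sum_sum_type, linearization, Matrix.fromBlocks_apply₁₁,
    Matrix.fromBlocks_apply₁₂, Matrix.fromBlocks_apply₂₁, Matrix.fromBlocks_apply₂₂,
    Matrix.zero_apply, norm_zero, Matrix.map_apply, Matrix.transpose_apply, scaledMatrix,
    Matrix.of_apply, Complex.norm_real, Real.norm_eq_abs, sq_abs]
  simp only [ne_eq, OfNat.ofNat_ne_zero, not_false_eq_true, zero_pow, Finset.sum_const_zero,
    zero_add, add_zero, h, h']
  nlinarith [sq_nonneg (s * ‖v‖)]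

theorem norm_sum_mul_coord_le (C : p → q → ℂ) {B : ℝ} (hB : 0 ≤ B)
    (hC : ∑ i, ∑ j, ‖C i j‖ ^ 2 ≤ B ^ 2) (x : EuclideanSpace ℝ (p × q)) :
    ‖∑ i, ∑ j, C i j * (x (i, j) : ℂ)‖ ≤ B * ‖x‖ := by
  refine (pow_le_pow_iff_left₀ (norm_nonneg _) (by positivity) two_ne_zero).1 ?_
  have h1 : ‖∑ i, ∑ j, C i j * (x (i, j) : ℂ)‖ ≤ ∑ k : p × q, ‖C k.1 k.2‖ * |x k| := by
    rw [Fintype.sum_prod_type]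
    refine (norm_sum_le _ _).trans (Finset.sum_le_sum fun i _ => (norm_sum_le _ _).trans ?_)
    simp
  calc _ ≤ (∑ k : p × q, ‖C k.1 k.2‖ * |x k|) ^ 2 := by gcongr
    _ ≤ (∑ k : p × q, ‖C k.1 k.2‖ ^ 2) * ∑ k, |x k| ^ 2 := Finset.sum_mul_sq_le_sq_mul_sq _ _ _
    _ ≤ B ^ 2 * ‖x‖ ^ 2 := by
      rw [EuclideanSpace.norm_sq_eq, Fintype.sum_prod_type]
      gcongr
      simp
    _ = _ := by ring

theorem sum_norm_sq_block_le (C : Matrix (p ⊕ q) (p ⊕ q) ℂ) :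
    ∑ i : p, ∑ j : q, ‖C (.inl i) (.inr j)‖ ^ 2 ≤ hsNorm C ^ 2 := by
  rw [hsNorm_sq, Fintype.sum_sum_type]
  refine le_add_of_le_of_nonneg (Finset.sum_le_sum fun i _ => ?_) (by positivity)
  rw [Fintype.sum_sum_type]
  exact le_add_of_nonneg_left (by positivity)

/-- Cauchy–Schwarz costs only the square root of the number of diagonal entries. For derivatives of
`R`, whose Hilbert–Schmidt norm carries a factor `s`, this root is absorbed by `s √N = 1`. -/
theorem norm_sum_diag_le_sqrt_mul_hsNorm {m n : Type*} [Fintype m] [Fintype n]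
    (C : Matrix n n ℂ) {e : m → n} (he : Function.Injective e) :
    ‖∑ i, C (e i) (e i)‖ ≤ √(Fintype.card m) * hsNorm C := by
  refine (pow_le_pow_iff_left₀ (norm_nonneg _)
    (mul_nonneg (Real.sqrt_nonneg _) (hsNorm_nonneg _)) two_ne_zero).1 ?_
  rw [mul_pow, Real.sq_sqrt (by positivity)]
  calc _ ≤ (∑ i, ‖C (e i) (e i)‖) ^ 2 := by gcongr; exact norm_sum_le _ _
    _ ≤ Fintype.card m * ∑ i, ‖C (e i) (e i)‖ ^ 2 := sq_sum_le_card_mul_sum_sq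
    _ ≤ _ := by
      gcongr
      rw [hsNorm_sq]
      have h1 : ∑ i, ‖C (e i) (e i)‖ ^ 2 ≤ ∑ k, ‖C k k‖ ^ 2 := by
        have := Finset.sum_map Finset.univ ⟨e, he⟩ fun k => ‖C k k‖ ^ 2
        simp only [Function.Embedding.coeFn_mk] at this
        rw [← this]
        exact Finset.sum_le_univ_sum_of_nonneg fun _ => by positivity
      refine h1.trans (Finset.sum_le_sum fun k _ => ?_)
      exact Finset.single_le_sum (f := fun j => ‖C k j‖ ^ 2) (fun _ _ => by positivity)
        (Finset.mem_univ k)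

variable [DecidableEq p] [DecidableEq q]

/-- The resolvent at `z` of the linearization of `A + s x`. -/
noncomputable def linRes (z : ℂ) (A : Matrix p q ℝ) (s : ℝ) (x : EuclideanSpace ℝ (p × q)) :
    Matrix (p ⊕ q) (p ⊕ q) ℂ :=
  (z • 1 - linearization (A + scaledMatrix s x))⁻¹

theorem norm_linRes_le {z : ℂ} (hz : z.im ≠ 0) (A : Matrix p q ℝ) (s : ℝ)
    (x : EuclideanSpace ℝ (p × q)) : ‖linRes z A s x‖ ≤ |z.im|⁻¹ :=
  (isHermitian_linearization _).norm_inv_smul_one_sub_le hz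

theorem smul_one_sub_linearization_apply (z : ℂ) (A : Matrix p q ℝ) (s : ℝ)
    (x : EuclideanSpace ℝ (p × q)) (a b : p ⊕ q) :
    (z • 1 - linearization (A + scaledMatrix s x)) a b
      = (z • 1 - linearization A) a b - linearizationEntry s a b x := by
  have : linearization (A + scaledMatrix s x) a b
      = linearization A a b + linearization (scaledMatrix s x) a b := by
    rcases a with a | a <;> rcases b with b | b <;> simp [linearization]
  rw [linearizationEntry_apply, Matrix.sub_apply, this, Matrix.sub_apply]
  ring

theorem contDiff_linRes_entry {z : ℂ} (hz : z.im ≠ 0) (A : Matrix p q ℝ) (s : ℝ) (a b : p ⊕ q) :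
    ContDiff ℝ 1 fun x => linRes z A s x a b := by
  refine contDiff_inv_entry (fun k l => ?_)
    (fun x => (isHermitian_linearization _).isUnit_smul_one_sub hz) a b
  simp only [smul_one_sub_linearization_apply]
  exact contDiff_const.sub (linearizationEntry s k l).contDiff

/-- The sign is positive because the linearization enters `z - H` negatively. -/
theorem fderiv_linRes_entry {z : ℂ} (hz : z.im ≠ 0) (A : Matrix p q ℝ) (s : ℝ) (a b : p ⊕ q)
    (x v : EuclideanSpace ℝ (p × q)) :
    fderiv ℝ (fun x => linRes z A s x a b) x v
      = (linRes z A s x * linearization (scaledMatrix s v) * linRes z A s x) a b := by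
  have hfun : ∀ k l, (fun x => (z • 1 - linearization (A + scaledMatrix s x)) k l)
      = fun x => (z • 1 - linearization A) k l - linearizationEntry s k l x := fun k l =>
    funext fun x => smul_one_sub_linearization_apply z A s x k l
  have h := fderiv_inv_entry (M := fun x => z • 1 - linearization (A + scaledMatrix s x))
    (fun k l => by
      rw [hfun]
      exact contDiff_const.sub (linearizationEntry s k l).contDiff)
    (fun x => (isHermitian_linearization _).isUnit_smul_one_sub hz) x v a b
  have hM : (Matrix.of fun k l =>
      fderiv ℝ (fun x => (z • 1 - linearization (A + scaledMatrix s x)) k l) x v)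
      = -linearization (scaledMatrix s v) := by
    ext k l
    rw [Matrix.of_apply, hfun, fderiv_const_sub, ContinuousLinearMap.fderiv]
    rfl
  rw [hM] at h
  simp only [mul_neg, neg_mul, Matrix.neg_apply, neg_neg] at h
  exact h

/-- Each row of `C` has Euclidean norm at most `ρ`, so only the number of rows of the block counts.
-/
theorem sum_norm_sq_block_le_card (C : Matrix (p ⊕ q) (p ⊕ q) ℂ) {ρ : ℝ} (hC : ‖C‖ ≤ ρ) :
    ∑ i : p, ∑ j : q, ‖C (.inl i) (.inr j)‖ ^ 2 ≤ Fintype.card p * ρ ^ 2 := by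
  have : ∀ i : p, ∑ j : q, ‖C (.inl i) (.inr j)‖ ^ 2 ≤ ρ ^ 2 := by
    intro i
    have h := sum_norm_sq_row_le C (.inl i)
    rw [Fintype.sum_sum_type] at h
    have h2 : 0 ≤ ∑ j : p, ‖C (.inl i) (.inl j)‖ ^ 2 := by positivity
    have h3 := pow_le_pow_left₀ (norm_nonneg C) hC 2
    linarith
  refine (Finset.sum_le_sum fun i _ => this i).trans ?_
  simp

theorem norm_sum_diag_le {m n : Type*} [Fintype m] [Fintype n] [DecidableEq n]
    (C : Matrix n n ℂ) (e : m → n) : ‖∑ i, C (e i) (e i)‖ ≤ Fintype.card m * ‖C‖ := by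
  refine (norm_sum_le _ _).trans ((Finset.sum_le_sum fun i _ => norm_entry_le C _ _).trans ?_)
  simp

/-- The integrand of the Gaussian integration by parts for `∑ R_{ij} x_{ij}`, up to a small term:
`s ∑ R_{ij} x_{ij} - s² Tr R₁₁ Tr R₂₂`. -/
noncomputable def discrepancy (z : ℂ) (A : Matrix p q ℝ) (s : ℝ) (x : EuclideanSpace ℝ (p × q)) :
    ℂ :=
  s * ∑ i, ∑ j, linRes z A s x (.inl i) (.inr j) * (x (i, j) : ℂ)
    - s ^ 2 * ((∑ i, linRes z A s x (.inl i) (.inl i)) * ∑ j, linRes z A s x (.inr j) (.inr j))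

theorem contDiff_discrepancy {z : ℂ} (hz : z.im ≠ 0) (A : Matrix p q ℝ) (s : ℝ) :
    ContDiff ℝ 1 (discrepancy z A s) := by
  have hx : ∀ k : p × q, ContDiff ℝ 1 fun x : EuclideanSpace ℝ (p × q) => ((x k : ℝ) : ℂ) :=
    fun k => Complex.ofRealCLM.contDiff.comp (EuclideanSpace.proj (𝕜 := ℝ) k).contDiff
  unfold discrepancy
  refine (contDiff_const.mul (ContDiff.sum fun i _ => ContDiff.sum fun j _ =>
    (contDiff_linRes_entry hz A s _ _).mul (hx _))).sub (contDiff_const.mul ((ContDiff.sum fun i _ =>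
    contDiff_linRes_entry hz A s _ _).mul (ContDiff.sum fun i _ =>
    contDiff_linRes_entry hz A s _ _)))

theorem fderiv_discrepancy {z : ℂ} (hz : z.im ≠ 0) (A : Matrix p q ℝ) (s : ℝ)
    (x v : EuclideanSpace ℝ (p × q)) {R C : Matrix (p ⊕ q) (p ⊕ q) ℂ} (hR : R = linRes z A s x)
    (hC : C = R * linearization (scaledMatrix s v) * R) :
    fderiv ℝ (discrepancy z A s) x v
      = s * ((∑ i, ∑ j, C (.inl i) (.inr j) * (x (i, j) : ℂ))
          + ∑ i, ∑ j, R (.inl i) (.inr j) * (v (i, j) : ℂ))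
        - s ^ 2 * ((∑ i, C (.inl i) (.inl i)) * (∑ j, R (.inr j) (.inr j))
          + (∑ i, R (.inl i) (.inl i)) * ∑ j, C (.inr j) (.inr j)) := by
  have hres : ∀ a b, HasDerivAt (fun t : ℝ => linRes z A s (x + t • v) a b) (C a b) 0 := by
    intro a b
    have h := ((contDiff_linRes_entry hz A s a b).differentiable one_ne_zero
      x).hasFDerivAt.hasLineDerivAt v
    rw [fderiv_linRes_entry hz, ← hR, ← hC] at h
    exact h
  have hx : ∀ k, HasDerivAt (fun t : ℝ => (((x + t • v) k : ℝ) : ℂ)) (v k : ℂ) 0 := by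
    intro k
    have h : HasDerivAt (fun t : ℝ => x k + t * v k) (v k) 0 := by
      simpa using ((hasDerivAt_id (0 : ℝ)).mul_const (v k)).const_add (x k)
    simpa using h.ofReal_comp
  have h1 : HasDerivAt (fun t : ℝ => discrepancy z A s (x + t • v))
      (fderiv ℝ (discrepancy z A s) x v) 0 :=
    ((contDiff_discrepancy hz A s).differentiable one_ne_zero x).hasFDerivAt.hasLineDerivAt v
  have h2 := (HasDerivAt.const_mul (s : ℂ) (HasDerivAt.fun_sum fun (i : p) (_ : i ∈ Finset.univ) =>
    HasDerivAt.fun_sum fun (j : q) (_ : j ∈ Finset.univ) =>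
      (hres (.inl i) (.inr j)).fun_mul (hx (i, j)))).fun_sub (HasDerivAt.const_mul ((s : ℂ) ^ 2)
    ((HasDerivAt.fun_sum fun (i : p) (_ : i ∈ Finset.univ) => hres (.inl i) (.inl i)).fun_mul
      (HasDerivAt.fun_sum fun (j : q) (_ : j ∈ Finset.univ) => hres (.inr j) (.inr j))))
  rw [h1.unique h2]
  simp only [zero_smul, add_zero, ← hR, Finset.sum_add_distrib]

/-- A crude bound using no cancellation. It serves where `‖x‖` is large and for boundedness of the
damped function. -/
theorem norm_discrepancy_le {z : ℂ} (hz : z.im ≠ 0) (A : Matrix p q ℝ) {s K : ℝ} (hs : 0 ≤ s)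
    (hsN : s ^ 2 * Fintype.card p = 1) (hK : (Fintype.card q : ℝ) ≤ K * Fintype.card p)
    (x : EuclideanSpace ℝ (p × q)) :
    ‖discrepancy z A s x‖ ≤ |z.im|⁻¹ * ‖x‖ + K * Fintype.card p * |z.im|⁻¹ ^ 2 := by
  set ρ := |z.im|⁻¹
  have hρ : 0 ≤ ρ := by positivity
  set R := linRes z A s x with hRdef
  have hR : ‖R‖ ≤ ρ := norm_linRes_le hz A s x
  set N : ℝ := (Fintype.card p : ℝ) with hN
  have hN0 : 0 ≤ N := by positivity
  have hsN' : s * √N = 1 := mul_sqrt_eq_one hs hsN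
  have h1 : ‖∑ i, ∑ j, R (.inl i) (.inr j) * (x (i, j) : ℂ)‖ ≤ √N * ρ * ‖x‖ := by
    refine norm_sum_mul_coord_le _ (by positivity) ?_ x
    rw [mul_pow, Real.sq_sqrt hN0]
    exact sum_norm_sq_block_le_card R hR
  have h2 : ‖∑ i : p, R (.inl i) (.inl i)‖ ≤ N * ρ :=
    (norm_sum_diag_le R Sum.inl).trans (by gcongr)
  have hKN : 0 ≤ K * N := le_trans (by positivity) hK
  have h3 : ‖∑ i : q, R (.inr i) (.inr i)‖ ≤ K * N * ρ :=
    (norm_sum_diag_le R Sum.inr).trans (by gcongr)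
  unfold discrepancy
  rw [← hRdef]
  calc _ ≤ s * (√N * ρ * ‖x‖) + s ^ 2 * (N * ρ * (K * N * ρ)) := by
        refine (norm_sub_le _ _).trans ?_
        rw [norm_mul, norm_mul, norm_mul, norm_pow, Complex.norm_real, Real.norm_of_nonneg hs]
        gcongr
    _ = (s * √N) * (ρ * ‖x‖) + (s ^ 2 * N) * (K * N * ρ ^ 2) := by ring
    _ = _ := by rw [hsN', hsN]; ring

/-- The term in `‖x‖ / N` comes from differentiating `R` in `∑ R_ij x_ij`. It is the only one not
bounded uniformly in `N`, and it dictates a weight at scale `‖x‖ ~ N`. -/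
theorem norm_fderiv_discrepancy_le {z : ℂ} (hz : z.im ≠ 0) (A : Matrix p q ℝ) {s K : ℝ}
    (hs : 0 ≤ s) (hsN : s ^ 2 * Fintype.card p = 1)
    (hK : (Fintype.card q : ℝ) ≤ K * Fintype.card p) (hK0 : 0 ≤ K)
    (x v : EuclideanSpace ℝ (p × q)) :
    ‖fderiv ℝ (discrepancy z A s) x v‖ ≤ (2 * |z.im|⁻¹ ^ 2 * ‖x‖ / Fintype.card p + |z.im|⁻¹
      + (2 + 4 * K) * |z.im|⁻¹ ^ 3) * ‖v‖ := by
  set ρ := |z.im|⁻¹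
  have hρ : 0 ≤ ρ := by positivity
  obtain ⟨R, hRdef⟩ : ∃ R, R = linRes z A s x := ⟨_, rfl⟩
  obtain ⟨C, hCdef⟩ : ∃ C, C = R * linearization (scaledMatrix s v) * R := ⟨_, rfl⟩
  have hR : ‖R‖ ≤ ρ := hRdef ▸ norm_linRes_le hz A s x
  have hC : hsNorm C ≤ 2 * s * ρ ^ 2 * ‖v‖ := by
    rw [hCdef]
    calc _ ≤ ‖R‖ * hsNorm (linearization (scaledMatrix s v)) * ‖R‖ := hsNorm_mul_mul_le _ _ _
      _ ≤ ρ * (2 * s * ‖v‖) * ρ := by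
        gcongr
        · exact hsNorm_nonneg _
        · exact hsNorm_linearization_scaledMatrix_le hs v
      _ = _ := by ring
  rw [fderiv_discrepancy hz A s x v hRdef hCdef]
  set N : ℝ := (Fintype.card p : ℝ) with hN
  have hN0 : 0 < N := pos_of_sq_mul_eq_one (by positivity) hsN
  have hsN' : s * √N = 1 := mul_sqrt_eq_one hs hsN
  have hCn := hsNorm_nonneg C
  have h0 : ‖∑ i, ∑ j, C (.inl i) (.inr j) * (x (i, j) : ℂ)‖ ≤ 2 * s * ρ ^ 2 * ‖v‖ * ‖x‖ :=
    (norm_sum_mul_coord_le _ hCn (sum_norm_sq_block_le C) x).trans (by gcongr)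
  have h1 : ‖∑ i, ∑ j, R (.inl i) (.inr j) * (v (i, j) : ℂ)‖ ≤ √N * ρ * ‖v‖ := by
    refine norm_sum_mul_coord_le _ (by positivity) ?_ v
    rw [mul_pow, Real.sq_sqrt hN0.le]
    exact sum_norm_sq_block_le_card R hR
  have h2 : ‖∑ i : p, R (.inl i) (.inl i)‖ ≤ N * ρ :=
    (norm_sum_diag_le R Sum.inl).trans (by gcongr)
  have h3 : ‖∑ i : q, R (.inr i) (.inr i)‖ ≤ K * N * ρ :=
    (norm_sum_diag_le R Sum.inr).trans (by gcongr)
  have h4 : ‖∑ i : p, C (.inl i) (.inl i)‖ ≤ √N * (2 * s * ρ ^ 2 * ‖v‖) :=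
    (norm_sum_diag_le_sqrt_mul_hsNorm C Sum.inl_injective).trans (by gcongr)
  have h5 : ‖∑ i : q, C (.inr i) (.inr i)‖ ≤ (1 + K) * √N * (2 * s * ρ ^ 2 * ‖v‖) := by
    refine (norm_sum_diag_le_sqrt_mul_hsNorm C Sum.inr_injective).trans ?_
    gcongr
    -- `K ≤ (1 + K)²` replaces `√K` by `1 + K`, keeping the constants polynomial in `K`.
    refine Real.sqrt_le_iff.2 ⟨by positivity, hK.trans ?_⟩
    rw [mul_pow, Real.sq_sqrt hN0.le]
    gcongr
    nlinarith
  calc _ ≤ s * (2 * s * ρ ^ 2 * ‖v‖ * ‖x‖ + √N * ρ * ‖v‖)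
        + s ^ 2 * (√N * (2 * s * ρ ^ 2 * ‖v‖) * (K * N * ρ)
          + N * ρ * ((1 + K) * √N * (2 * s * ρ ^ 2 * ‖v‖))) := by
        refine (norm_sub_le _ _).trans ?_
        rw [norm_mul, norm_mul, norm_pow, Complex.norm_real, Real.norm_of_nonneg hs]
        refine add_le_add (mul_le_mul_of_nonneg_left ((norm_add_le _ _).trans (add_le_add h0 h1)) hs)
          (mul_le_mul_of_nonneg_left ((norm_add_le _ _).trans ?_) (by positivity))
        rw [norm_mul, norm_mul]
        gcongr
    _ = (2 * ρ ^ 2 * ‖x‖ * s ^ 2 + (s * √N) * ρ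
        + (s * √N) * (s ^ 2 * N) * (2 + 4 * K) * ρ ^ 3) * ‖v‖ := by ring
    _ = _ := by
      rw [hsN', hsN, show s ^ 2 = 1 / N by rw [eq_div_iff hN0.ne', hsN]]
      ring

end Linearization

/-! ### The smooth weight at scale `‖x‖ ~ N`. -/

section Damping

variable {E : Type*} [NormedAddCommGroup E]

/-- The smooth weight `(1 + ‖x‖² / N²)⁻¹`. -/
noncomputable def damping (N : ℝ) (x : E) : ℝ := (1 + ‖x‖ ^ 2 / N ^ 2)⁻¹

theorem damping_pos (N : ℝ) (x : E) : 0 < damping N x := by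
  unfold damping
  positivity

theorem damping_le_one (N : ℝ) (x : E) : damping N x ≤ 1 :=
  inv_le_one_of_one_le₀ (le_add_of_nonneg_right (by positivity))

theorem norm_sq_mul_damping_le {N : ℝ} (hN : 0 < N) (x : E) : ‖x‖ ^ 2 * damping N x ≤ N ^ 2 := by
  unfold damping
  rw [← div_eq_mul_inv, div_le_iff₀ (by positivity)]
  have : N ^ 2 * (1 + ‖x‖ ^ 2 / N ^ 2) = N ^ 2 + ‖x‖ ^ 2 := by field_simp
  rw [this]
  exact le_add_of_nonneg_left (by positivity)

theorem norm_mul_damping_le {N : ℝ} (hN : 0 < N) (x : E) : ‖x‖ * damping N x ≤ N := by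
  unfold damping
  rw [← div_eq_mul_inv, div_le_iff₀ (by positivity)]
  have : N * (1 + ‖x‖ ^ 2 / N ^ 2) = (N ^ 2 + ‖x‖ ^ 2) / N := by field_simp
  rw [this, le_div_iff₀ hN]
  nlinarith [sq_nonneg (N - ‖x‖), sq_nonneg N, sq_nonneg ‖x‖]

variable [InnerProductSpace ℝ E]

theorem contDiff_damping (N : ℝ) : ContDiff ℝ 1 (damping N : E → ℝ) := by
  unfold damping
  refine ContDiff.inv (contDiff_const.add ((contDiff_norm_sq ℝ).div_const _)) fun x => ?_
  positivity

theorem fderiv_damping (N : ℝ) (x v : E) :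
    fderiv ℝ (damping N) x v = -(damping N x ^ 2 * (2 * inner ℝ x v / N ^ 2)) := by
  have h1 : HasFDerivAt (fun x : E => 1 + ‖x‖ ^ 2 / N ^ 2)
      ((N ^ 2)⁻¹ • (2 • innerSL ℝ x)) x := by
    simpa only [div_eq_inv_mul] using
      ((hasStrictFDerivAt_norm_sq x).hasFDerivAt.const_mul (N ^ 2)⁻¹).const_add 1
  have h0 : (1 + ‖x‖ ^ 2 / N ^ 2) ≠ 0 := by positivity
  have h2 := (hasDerivAt_inv h0).comp_hasFDerivAt x h1
  have h3 : HasFDerivAt (damping N) _ x := h2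
  rw [h3.fderiv]
  simp [damping, innerSL_apply_apply]
  left
  ring

theorem abs_fderiv_damping_le (N : ℝ) (x v : E) :
    |fderiv ℝ (damping N) x v| ≤ damping N x ^ 2 * (2 * ‖x‖ / N ^ 2) * ‖v‖ := by
  rw [fderiv_damping, abs_neg, abs_mul, abs_of_nonneg (by positivity : 0 ≤ damping N x ^ 2),
    abs_div, abs_mul, abs_of_nonneg (by positivity : 0 ≤ N ^ 2), mul_assoc]
  have := abs_real_inner_le_norm x v
  gcongr
  rw [div_mul_eq_mul_div, abs_two, mul_assoc]
  gcongr

end Damping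

/-! ### The damped discrepancy: Lipschitz constant and mean. -/

section DampedDiscrepancy

open scoped Matrix.Norms.L2Operator

variable {p q : Type*} [Fintype p] [Fintype q] [DecidableEq p] [DecidableEq q]

theorem fderiv_damping_mul {E : Type*} [NormedAddCommGroup E] [InnerProductSpace ℝ E]
    {g : E → ℂ} (hg : ContDiff ℝ 1 g) (N : ℝ) (x v : E) :
    fderiv ℝ (fun x => (damping N x : ℂ) * g x) x v
      = (damping N x : ℂ) * fderiv ℝ g x v + (fderiv ℝ (damping N) x v : ℂ) * g x := by
  have h1 : HasFDerivAt (fun x => (damping N x : ℂ))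
      (Complex.ofRealCLM.comp (fderiv ℝ (damping N) x)) x :=
    Complex.ofRealCLM.hasFDerivAt.comp x
      ((contDiff_damping N).differentiable one_ne_zero x).hasFDerivAt
  rw [(h1.fun_mul ((hg.differentiable one_ne_zero) x).hasFDerivAt).fderiv]
  simp [mul_comm]

theorem contDiff_damping_mul {E : Type*} [NormedAddCommGroup E] [InnerProductSpace ℝ E]
    {g : E → ℂ} (hg : ContDiff ℝ 1 g) (N : ℝ) :
    ContDiff ℝ 1 (fun x => (damping N x : ℂ) * g x) :=
  (Complex.ofRealCLM.contDiff.comp (contDiff_damping N)).mul hg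

variable {z : ℂ} (A : Matrix p q ℝ) {s K : ℝ}

/-- Writing `ψ` for the weight, `ψ ‖x‖ ≤ N` and `ψ ‖x‖² ≤ N²` absorb both the growing part of the
gradient of `D` and the product of `D` with the gradient of `ψ`. -/
theorem norm_fderiv_damping_mul_discrepancy_le (hz : z.im ≠ 0) (hz1 : |z.im| ≤ 1) (hs : 0 ≤ s)
    (hsN : s ^ 2 * Fintype.card p = 1) (hK : (Fintype.card q : ℝ) ≤ K * Fintype.card p)
    (hK0 : 0 ≤ K) (x : EuclideanSpace ℝ (p × q)) :
    ‖fderiv ℝ (fun x => (damping (Fintype.card p) x : ℂ) * discrepancy z A s x) x‖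
      ≤ (7 + 6 * K) * |z.im|⁻¹ ^ 3 := by
  refine ContinuousLinearMap.opNorm_le_bound _ (by positivity) fun v => ?_
  have hρ1 : 1 ≤ |z.im|⁻¹ := (one_le_inv₀ (abs_pos.2 hz)).2 hz1
  have hd := norm_discrepancy_le hz A hs hsN hK x
  have hd' := norm_fderiv_discrepancy_le hz A hs hsN hK hK0 x v
  rw [fderiv_damping_mul (contDiff_discrepancy hz A s)]
  set ρ := |z.im|⁻¹
  set N : ℝ := (Fintype.card p : ℝ) with hN
  have hN0 : 0 < N := pos_of_sq_mul_eq_one (by positivity) hsN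
  have ha := abs_fderiv_damping_le N x v
  set ψ := damping N x with hψ
  have hψ0 : 0 < ψ := damping_pos N x
  have hψ1 : ψ ≤ 1 := damping_le_one N x
  have hx1 : ‖x‖ * ψ / N ≤ 1 := (div_le_one hN0).2 (norm_mul_damping_le hN0 x)
  have hx2 : ‖x‖ ^ 2 * ψ / N ^ 2 ≤ 1 :=
    (div_le_one (by positivity)).2 (norm_sq_mul_damping_le hN0 x)
  calc _ ≤ ψ * ((2 * ρ ^ 2 * ‖x‖ / N + ρ + (2 + 4 * K) * ρ ^ 3) * ‖v‖)
        + ψ ^ 2 * (2 * ‖x‖ / N ^ 2) * ‖v‖ * (ρ * ‖x‖ + K * N * ρ ^ 2) := by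
        refine (norm_add_le _ _).trans ?_
        rw [norm_mul, norm_mul, Complex.norm_real, Complex.norm_real, Real.norm_of_nonneg hψ0.le,
          Real.norm_eq_abs]
        gcongr
    _ = (2 * ρ ^ 2 * (‖x‖ * ψ / N) + ψ * (ρ + (2 + 4 * K) * ρ ^ 3)
        + ψ * (2 * ρ * (‖x‖ ^ 2 * ψ / N ^ 2) + 2 * K * ρ ^ 2 * (‖x‖ * ψ / N))) * ‖v‖ := by
        field_simp
        ring
    _ ≤ (2 * ρ ^ 2 * 1 + 1 * (ρ + (2 + 4 * K) * ρ ^ 3)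
        + 1 * (2 * ρ * 1 + 2 * K * ρ ^ 2 * 1)) * ‖v‖ := by
        gcongr
    -- As `1 ≤ ρ`, every power of `ρ` is at most `ρ³`; the coefficients add up to `2 + 1 + (2 + 4K)
    -- + 2 + 2K = 7 + 6K`.
    _ ≤ _ := by
        gcongr
        have h2 : ρ ≤ ρ ^ 3 := by nlinarith [sq_nonneg ρ]
        have h3 : ρ ^ 2 ≤ ρ ^ 3 := by nlinarith [sq_nonneg ρ]
        nlinarith

theorem norm_damping_mul_discrepancy_le (hz : z.im ≠ 0) (hs : 0 ≤ s)
    (hsN : s ^ 2 * Fintype.card p = 1) (hK : (Fintype.card q : ℝ) ≤ K * Fintype.card p)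
    (hK0 : 0 ≤ K) (x : EuclideanSpace ℝ (p × q)) :
    ‖(damping (Fintype.card p) x : ℂ) * discrepancy z A s x‖
      ≤ |z.im|⁻¹ * Fintype.card p + K * Fintype.card p * |z.im|⁻¹ ^ 2 := by
  have hd := norm_discrepancy_le hz A hs hsN hK x
  have hN0 : (0 : ℝ) < Fintype.card p := pos_of_sq_mul_eq_one (by positivity) hsN
  have h1 := norm_mul_damping_le hN0 x
  have h0 := damping_pos (Fintype.card p : ℝ) x
  have h2 := damping_le_one (Fintype.card p : ℝ) x
  rw [norm_mul, Complex.norm_real, Real.norm_of_nonneg h0.le]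
  set ψ := damping (Fintype.card p : ℝ) x
  calc _ ≤ ψ * (|z.im|⁻¹ * ‖x‖ + K * Fintype.card p * |z.im|⁻¹ ^ 2) := by gcongr
    _ = |z.im|⁻¹ * (‖x‖ * ψ) + ψ * (K * Fintype.card p * |z.im|⁻¹ ^ 2) := by ring
    _ ≤ |z.im|⁻¹ * Fintype.card p + 1 * (K * Fintype.card p * |z.im|⁻¹ ^ 2) := by gcongr
    _ = _ := by ring

/-- The direction `(i, j)` perturbs the linearization by `s (E_ij + E_ji)`. One elementary matrix
yields the product of diagonal entries, the other the square. -/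
theorem mul_linearization_single_mul_apply (R : Matrix (p ⊕ q) (p ⊕ q) ℂ) (s : ℝ) (i : p) (j : q) :
    (R * linearization (scaledMatrix s (EuclideanSpace.single (i, j) 1)) * R) (.inl i) (.inr j)
      = s * (R (.inl i) (.inl i) * R (.inr j) (.inr j) + R (.inl i) (.inr j) ^ 2) := by
  have : linearization (scaledMatrix s (EuclideanSpace.single (i, j) 1))
      = (s : ℂ) • (Matrix.single (.inl i) (.inr j) 1 + Matrix.single (.inr j) (.inl i) 1) := by
    ext a b
    rcases a with a | a <;> rcases b with b | b <;>
      simp [linearization, scaledMatrix, Matrix.single_apply,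
        Prod.ext_iff, eq_comm, and_comm] <;>
      split_ifs <;> simp
  rw [this]
  simp only [Matrix.mul_smul, Matrix.smul_mul, Matrix.smul_apply, mul_add, add_mul,
    Matrix.add_apply, smul_eq_mul]
  simp [Matrix.mul_apply, Matrix.single_apply, Finset.sum_ite_eq, ite_and]
  left
  ring

/-- Integration by parts is applied to `ψ R_ij` in the coordinate `x_ij`. The products `R_ii R_jj`
sum to the product of traces and cancel; the squares and the derivative of `ψ` survive. -/
theorem integral_damping_mul_discrepancy (hz : z.im ≠ 0) (hs : 0 ≤ s)
    (hsN : s ^ 2 * Fintype.card p = 1) :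
    ∫ x, (damping (Fintype.card p) x : ℂ) * discrepancy z A s x
        ∂(stdGaussian (EuclideanSpace ℝ (p × q)))
      = ∫ x, ((s : ℂ) ^ 2 * (damping (Fintype.card p) x : ℂ)
            * (∑ i, ∑ j, linRes z A s x (.inl i) (.inr j) ^ 2)
          - 2 * s * (damping (Fintype.card p) x : ℂ) ^ 2 / (Fintype.card p : ℂ) ^ 2
            * ∑ i, ∑ j, linRes z A s x (.inl i) (.inr j) * (x (i, j) : ℂ))
        ∂(stdGaussian (EuclideanSpace ℝ (p × q))) := by
  set γ := stdGaussian (EuclideanSpace ℝ (p × q))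
  set N : ℝ := (Fintype.card p : ℝ) with hN
  have hN0 : 0 < N := pos_of_sq_mul_eq_one (by positivity) hsN
  have hNC : (Fintype.card p : ℂ) = (N : ℂ) := by simp [hN]
  rw [hNC]
  set ρ := |z.im|⁻¹ with hρdef
  have hρ : 0 ≤ ρ := by positivity
  have hRe : ∀ x a b, ‖linRes z A s x a b‖ ≤ ρ := fun x a b =>
    (norm_entry_le _ _ _).trans (norm_linRes_le hz A s x)
  let g : p → q → EuclideanSpace ℝ (p × q) → ℂ := fun i j x =>
    (damping N x : ℂ) * linRes z A s x (.inl i) (.inr j)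
  have hg : ∀ i j, ContDiff ℝ 1 (g i j) := fun i j =>
    contDiff_damping_mul (contDiff_linRes_entry hz A s _ _) N
  have hgB : ∀ i j x, ‖g i j x‖ ≤ ρ := fun i j x => by
    simp only [g]
    rw [norm_mul, Complex.norm_real, Real.norm_of_nonneg (damping_pos N x).le]
    calc _ ≤ 1 * ρ := by
          gcongr
          · exact damping_le_one N x
          · exact hRe _ _ _
      _ = ρ := one_mul ρ
  have hgB' : ∀ i j x, ‖fderiv ℝ (g i j) x‖ ≤ ρ ^ 2 * (2 * s) + 2 / N * ρ := fun i j x => by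
    refine ContinuousLinearMap.opNorm_le_bound _ (by positivity) fun v => ?_
    rw [fderiv_damping_mul (contDiff_linRes_entry hz A s _ _), fderiv_linRes_entry hz]
    have h1 : ‖(linRes z A s x * linearization (scaledMatrix s v) * linRes z A s x)
        (.inl i) (.inr j)‖ ≤ ρ * (2 * s * ‖v‖) * ρ := by
      refine (norm_entry_le_hsNorm _ _ _).trans ((hsNorm_mul_mul_le _ _ _).trans ?_)
      have h2 := hsNorm_linearization_scaledMatrix_le hs v
      have h3 := norm_linRes_le hz A s x
      have h4 := hsNorm_nonneg (linearization (scaledMatrix s v))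
      gcongr
    have h5 := abs_fderiv_damping_le N x v
    have h6 : damping N x ^ 2 * (2 * ‖x‖ / N ^ 2) ≤ 2 / N := by
      have h7 := norm_mul_damping_le hN0 x
      have h8 := damping_le_one N x
      have h9 := damping_pos N x
      calc _ = damping N x * (‖x‖ * damping N x) * (2 / N ^ 2) := by ring
        _ ≤ 1 * N * (2 / N ^ 2) := by gcongr
        _ = 2 / N := by field_simp
    refine (norm_add_le _ _).trans ?_
    rw [norm_mul, norm_mul, Complex.norm_real, Complex.norm_real,
      Real.norm_of_nonneg (damping_pos N x).le, Real.norm_eq_abs, add_mul]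
    have h10 : |fderiv ℝ (damping N) x v| ≤ 2 / N * ‖v‖ := h5.trans (by gcongr)
    calc _ ≤ 1 * (ρ * (2 * s * ‖v‖) * ρ) + 2 / N * ‖v‖ * ρ := by
          gcongr
          · exact damping_le_one N x
          · exact hRe _ _ _
      _ = _ := by ring
  have hnorm : Integrable (fun x : EuclideanSpace ℝ (p × q) => ‖x‖) γ :=
    (IsGaussian.integrable_id (μ := γ)).norm
  have hxg : ∀ i j, Integrable (fun x => g i j x * (x (i, j) : ℂ)) γ := fun i j => by
    have hgc := (hg i j).continuous
    refine (hnorm.const_mul ρ).mono' (Continuous.aestronglyMeasurable (by fun_prop))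
      (Filter.Eventually.of_forall fun x => ?_)
    rw [norm_mul, Complex.norm_real]
    gcongr
    · exact hgB i j x
    · exact PiLp.norm_apply_le x (i, j)
  have hdg : ∀ i j, Integrable (fun x => fderiv ℝ (g i j) x (EuclideanSpace.single (i, j) 1)) γ :=
    fun i j => by
    refine Integrable.of_bound (C := ρ ^ 2 * (2 * s) + 2 / N * ρ)
      (Continuous.aestronglyMeasurable ?_) (Filter.Eventually.of_forall fun x => ?_)
    · exact ((hg i j).continuous_fderiv one_ne_zero).clm_apply continuous_const
    · refine ((fderiv ℝ (g i j) x).le_opNorm _).trans ?_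
      simpa using hgB' i j x
  have hstein : ∀ i j, ∫ x, g i j x * (x (i, j) : ℂ) ∂γ
      = ∫ x, fderiv ℝ (g i j) x (EuclideanSpace.single (i, j) 1) ∂γ := fun i j => by
    rw [← integral_inner_smul_stdGaussian (hg i j) (hgB i j) (hgB' i j)]
    congr 1
    ext x
    simp [EuclideanSpace.inner_single_right, mul_comm]
  let t : EuclideanSpace ℝ (p × q) → ℂ := fun x => (s : ℂ) ^ 2 * ((damping N x : ℂ) *
    ((∑ i, linRes z A s x (.inl i) (.inl i)) * ∑ j, linRes z A s x (.inr j) (.inr j)))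
  have htc : Continuous t := by
    have h1 : ∀ a b, Continuous fun x => linRes z A s x a b := fun a b =>
      (contDiff_linRes_entry hz A s a b).continuous
    have h2 := (contDiff_damping (E := EuclideanSpace ℝ (p × q)) N).continuous
    fun_prop
  have hti : Integrable t γ := by
    refine Integrable.of_bound (C := s ^ 2 * (1 * ((Fintype.card p * ρ) * (Fintype.card q * ρ))))
      htc.aestronglyMeasurable (Filter.Eventually.of_forall fun x => ?_)
    have h1 := (norm_sum_diag_le (linRes z A s x) Sum.inl).trans
      (mul_le_mul_of_nonneg_left (norm_linRes_le hz A s x) (by positivity))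
    have h2 := (norm_sum_diag_le (linRes z A s x) Sum.inr).trans
      (mul_le_mul_of_nonneg_left (norm_linRes_le hz A s x) (by positivity))
    simp only [t]
    rw [norm_mul, norm_mul, norm_mul, norm_pow, Complex.norm_real, Complex.norm_real,
      Real.norm_of_nonneg hs, Real.norm_of_nonneg (damping_pos N x).le]
    gcongr
    exact damping_le_one N x
  have hsum : ∀ f : p → q → EuclideanSpace ℝ (p × q) → ℂ, (∀ i j, Integrable (f i j) γ) →
      Integrable (fun x => (s : ℂ) * ∑ i, ∑ j, f i j x) γ ∧
      ∫ x, (s : ℂ) * ∑ i, ∑ j, f i j x ∂γ = s * ∑ i, ∑ j, ∫ x, f i j x ∂γ := fun f hf => by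
    have h1 : ∀ i, Integrable (fun x => ∑ j, f i j x) γ := fun i =>
      integrable_finsetSum _ fun j _ => hf i j
    refine ⟨(integrable_finsetSum _ fun i _ => h1 i).const_mul _, ?_⟩
    rw [integral_const_mul, integral_finsetSum _ fun i _ => h1 i]
    congr 1
    refine Finset.sum_congr rfl fun i _ => ?_
    rw [integral_finsetSum _ fun j _ => hf i j]
  obtain ⟨hi1, he1⟩ := hsum _ hxg
  obtain ⟨hi2, he2⟩ := hsum _ hdg
  calc _ = ∫ x, ((s : ℂ) * ∑ i, ∑ j, g i j x * (x (i, j) : ℂ)) - t x ∂γ := by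
        congr 1
        ext x
        simp only [discrepancy, g, t, mul_sub, Finset.mul_sum]
        congr 1
        · exact Finset.sum_congr rfl fun i _ => Finset.sum_congr rfl fun j _ => by ring
        · ring_nf
    _ = ∫ x, ((s : ℂ) * ∑ i, ∑ j, fderiv ℝ (g i j) x (EuclideanSpace.single (i, j) 1))
          - t x ∂γ := by
        rw [integral_sub hi1 hti, integral_sub hi2 hti, he1, he2]
        simp only [hstein]
    _ = _ := by
        congr 1
        ext x
        simp only [g, t]
        have h1 : ∀ i j, fderiv ℝ (fun x => (damping N x : ℂ) * linRes z A s x (.inl i) (.inr j)) x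
            (EuclideanSpace.single (i, j) 1)
            = (damping N x : ℂ) * (s * (linRes z A s x (.inl i) (.inl i)
                * linRes z A s x (.inr j) (.inr j) + linRes z A s x (.inl i) (.inr j) ^ 2))
              - 2 * (damping N x : ℂ) ^ 2 / (N : ℂ) ^ 2
                * (linRes z A s x (.inl i) (.inr j) * (x (i, j) : ℂ)) := fun i j => by
          rw [fderiv_damping_mul (contDiff_linRes_entry hz A s _ _), fderiv_linRes_entry hz,
            mul_linearization_single_mul_apply, fderiv_damping, EuclideanSpace.inner_single_right]
          simp
          ring
        simp only [h1, Finset.sum_sub_distrib, ← Finset.mul_sum, Finset.sum_add_distrib]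
        rw [← Finset.sum_mul]
        ring

/-- The squares contribute at most `s² N ρ² = ρ²` and the derivative of the weight at most `2ρ / N`,
hence the constant `3` after using `1 ≤ ρ`. -/
theorem norm_integral_damping_mul_discrepancy_le (hz : z.im ≠ 0) (hz1 : |z.im| ≤ 1) (hs : 0 ≤ s)
    (hsN : s ^ 2 * Fintype.card p = 1) :
    ‖∫ x, (damping (Fintype.card p) x : ℂ) * discrepancy z A s x
        ∂(stdGaussian (EuclideanSpace ℝ (p × q)))‖ ≤ 3 * |z.im|⁻¹ ^ 3 := by
  rw [integral_damping_mul_discrepancy A hz hs hsN]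
  have hρ1 : 1 ≤ |z.im|⁻¹ := (one_le_inv₀ (abs_pos.2 hz)).2 hz1
  set N : ℝ := (Fintype.card p : ℝ) with hN
  have hN0 : 0 < N := pos_of_sq_mul_eq_one (by positivity) hsN
  have hN1 : 1 ≤ N := by
    rw [hN] at hN0 ⊢
    exact_mod_cast hN0
  have hNC : (Fintype.card p : ℂ) = (N : ℂ) := by simp [hN]
  rw [hNC]
  refine (norm_integral_le_of_norm_le_const (Filter.Eventually.of_forall fun x => ?_)).trans
    (by rw [probReal_univ, mul_one])
  set ρ := |z.im|⁻¹ with hρdef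
  have hR := norm_linRes_le hz A s x
  have hblock := sum_norm_sq_block_le_card (linRes z A s x) hR
  have hsN' : s * √N = 1 := mul_sqrt_eq_one hs hsN
  have h1 : ‖∑ i, ∑ j, linRes z A s x (.inl i) (.inr j) ^ 2‖ ≤ N * ρ ^ 2 := by
    refine le_trans ((norm_sum_le _ _).trans (Finset.sum_le_sum fun i _ =>
      (norm_sum_le _ _).trans (Finset.sum_le_sum fun j _ => (norm_pow _ 2).le))) hblock
  have h2 : ‖∑ i, ∑ j, linRes z A s x (.inl i) (.inr j) * (x (i, j) : ℂ)‖ ≤ √N * ρ * ‖x‖ := by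
    refine norm_sum_mul_coord_le _ (by positivity) ?_ x
    rw [mul_pow, Real.sq_sqrt hN0.le]
    exact hblock
  have h3 := damping_le_one N x
  have h4 := damping_pos N x
  have h5 := norm_mul_damping_le hN0 x
  refine (norm_sub_le _ _).trans ?_
  simp only [norm_mul, norm_div, norm_pow, Complex.norm_real, Real.norm_of_nonneg hs,
    Real.norm_of_nonneg h4.le, Real.norm_of_nonneg hN0.le, Complex.norm_ofNat]
  calc _ ≤ s ^ 2 * 1 * (N * ρ ^ 2) + 2 * s * damping N x ^ 2 / N ^ 2 * (√N * ρ * ‖x‖) := by gcongr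
    _ = (s ^ 2 * N) * ρ ^ 2
        + 2 * (s * √N) * damping N x / N ^ 2 * ρ * (‖x‖ * damping N x) := by ring
    _ ≤ 1 * ρ ^ 2 + 2 * 1 * 1 / N ^ 2 * ρ * N := by
      rw [hsN', hsN]
      gcongr
    _ = ρ ^ 2 + 2 * ρ / N := by field_simp
    _ ≤ ρ ^ 2 + 2 * ρ := by
      gcongr
      exact div_le_self (by positivity) hN1
    _ ≤ _ := by
      have h6 : ρ ≤ ρ ^ 3 := by nlinarith [sq_nonneg ρ]
      have h7 : ρ ^ 2 ≤ ρ ^ 3 := by nlinarith [sq_nonneg ρ]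
      linarith

end DampedDiscrepancy

/-! ### Removing the weight: the sub-Gaussian bound. -/

section SubGaussian

open scoped Matrix.Norms.L2Operator

theorem exp_half_add_le (a b : ℝ) : Real.exp ((a + b) / 2) ≤ (Real.exp a + Real.exp b) / 2 := by
  have h := convexOn_exp.2 (Set.mem_univ a) (Set.mem_univ b)
    (by norm_num : (0 : ℝ) ≤ 1 / 2) (by norm_num : (0 : ℝ) ≤ 1 / 2) (by norm_num)
  simp only [smul_eq_mul] at h
  calc _ = Real.exp (1 / 2 * a + 1 / 2 * b) := by ring_nf
    _ ≤ _ := by linarith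

/-- Convexity between `0` and `a`. It turns an exponential moment bounded by `7` into one bounded by
`5/6 + 7/6 = 2`. -/
theorem exp_div_six_le (a : ℝ) : Real.exp (a / 6) ≤ 5 / 6 + Real.exp a / 6 := by
  have h := convexOn_exp.2 (Set.mem_univ a) (Set.mem_univ 0)
    (by norm_num : (0 : ℝ) ≤ 1 / 6) (by norm_num : (0 : ℝ) ≤ 5 / 6) (by norm_num)
  simp only [smul_eq_mul, mul_zero, add_zero, Real.exp_zero] at h
  calc _ = Real.exp (1 / 6 * a) := by ring_nf
    _ ≤ _ := by linarith

/-- Gaussian concentration for complex-valued functions, in terms of real and imaginary parts. -/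
theorem lintegral_exp_sq_re_sub_integral_le {E : Type*} [NormedAddCommGroup E]
    [InnerProductSpace ℝ E] [FiniteDimensional ℝ E] [MeasurableSpace E] [BorelSpace E]
    {f : E → ℂ} (hf : ContDiff ℝ 1 f) {L B c : ℝ} (hL : ∀ x, ‖fderiv ℝ f x‖ ≤ L)
    (hB : ∀ x, ‖f x‖ ≤ B) (hc : 0 ≤ c) (hcL : c * (Real.pi / 2) ^ 2 * L ^ 2 ≤ 1 / 4) :
    ∫⁻ y, ENNReal.ofReal (Real.exp (c * ((f y - ∫ x, f x ∂(stdGaussian E)).re) ^ 2))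
      ∂(stdGaussian E) ≤ 2 ∧
    ∫⁻ y, ENNReal.ofReal (Real.exp (c * ((f y - ∫ x, f x ∂(stdGaussian E)).im) ^ 2))
      ∂(stdGaussian E) ≤ 2 := by
  have hi : Integrable f (stdGaussian E) :=
    Integrable.of_bound hf.continuous.aestronglyMeasurable B (Filter.Eventually.of_forall hB)
  have key : ∀ l : ℂ →L[ℝ] ℝ, ‖l‖ ≤ 1 → (∀ w, |l w| ≤ ‖w‖) →
      ∫⁻ y, ENNReal.ofReal (Real.exp (c * (l (f y - ∫ x, f x ∂(stdGaussian E))) ^ 2))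
        ∂(stdGaussian E) ≤ 2 := by
    intro l hl hl'
    have h := lintegral_exp_sq_sub_integral_stdGaussian_le (f := fun x => l (f x))
      (l.contDiff.comp hf) (L := L) (B := B) (c := c) (fun x => ?_)
      (fun x => (hl' _).trans (hB x)) hc hcL
    · rw [l.integral_comp_comm hi] at h
      simpa only [map_sub] using h
    · have h1 : HasFDerivAt (fun x => l (f x)) (l.comp (fderiv ℝ f x)) x :=
        l.hasFDerivAt.comp x (hf.differentiable one_ne_zero x).hasFDerivAt
      rw [h1.fderiv]
      calc _ ≤ ‖l‖ * ‖fderiv ℝ f x‖ := l.opNorm_comp_le _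
        _ ≤ 1 * L := by
          gcongr
          exact hL x
        _ = L := one_mul L
  exact ⟨key Complex.reCLM Complex.reCLM_norm.le Complex.abs_re_le_norm,
    key Complex.imCLM Complex.imCLM_norm.le Complex.abs_im_le_norm⟩

variable {p q : Type*} [Fintype p] [Fintype q] [DecidableEq p] [DecidableEq q]

/-- The two summands correspond to the regions `‖x‖² ≤ T N²`, where the weight is at least `1 / (1 +
T)`, and `‖x‖² > T N²`. -/
theorem exp_sq_norm_discrepancy_le {z : ℂ} (hz : z.im ≠ 0) (hz1 : |z.im| ≤ 1) (A : Matrix p q ℝ)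
    {s K : ℝ} (hs : 0 ≤ s) (hsN : s ^ 2 * Fintype.card p = 1)
    (hK : (Fintype.card q : ℝ) ≤ K * Fintype.card p) (hK0 : 0 ≤ K)
    {F : EuclideanSpace ℝ (p × q) → ℂ} {F₀ : ℂ} {T u c : ℝ} (hT : 1 ≤ T) (hu : 0 ≤ u)
    (hF : ∀ x, F x = ((|z.im| : ℝ) : ℂ) ^ 3 * ((damping (Fintype.card p) x : ℂ) * discrepancy z A s x))
    (hF₀ : ‖F₀‖ ≤ 3) (huc : 4 * (1 + T) ^ 2 * u ≤ c) (hu1 : 18 * (1 + T) ^ 2 * u ≤ 1)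
    (x : EuclideanSpace ℝ (p × q)) :
    Real.exp (u * (|z.im| ^ 3 * ‖discrepancy z A s x‖) ^ 2)
      ≤ Real.exp 1 / 2 * (Real.exp (c * (F x - F₀).re ^ 2) + Real.exp (c * (F x - F₀).im ^ 2))
        + Real.exp (2 * (u * (1 + K) ^ 2) * ‖x‖ ^ 2
          - u * (1 + K) ^ 2 * (T * (Fintype.card p : ℝ) ^ 2)) := by
  have hη := abs_pos.2 hz
  have hN0 : (0 : ℝ) < Fintype.card p := pos_of_sq_mul_eq_one (by positivity) hsN
  have hd := norm_discrepancy_le hz A hs hsN hK x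
  set N : ℝ := (Fintype.card p : ℝ) with hN
  set D := ‖discrepancy z A s x‖ with hD
  have hD0 : 0 ≤ D := norm_nonneg _
  rcases le_or_gt (‖x‖ ^ 2) (T * N ^ 2) with hx | hx
  · refine le_add_of_le_of_nonneg ?_ (Real.exp_pos _).le
    have hFx : |z.im| ^ 3 * D ≤ (1 + T) * ‖F x‖ := by
      have h1 : ‖F x‖ = |z.im| ^ 3 * (damping N x * D) := by
        rw [hF, norm_mul, norm_mul, norm_pow, Complex.norm_real, Complex.norm_real,
          Real.norm_of_nonneg hη.le, Real.norm_of_nonneg (damping_pos _ _).le]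
      have h2 : 1 ≤ (1 + T) * damping N x := by
        unfold damping
        rw [← div_eq_mul_inv, one_le_div (by positivity)]
        gcongr
        rwa [div_le_iff₀ (by positivity)]
      rw [h1]
      calc _ = |z.im| ^ 3 * D * 1 := by ring
        _ ≤ |z.im| ^ 3 * D * ((1 + T) * damping N x) := by gcongr
        _ = _ := by ring
    have hU : ‖F x‖ ≤ ‖F x - F₀‖ + 3 := by
      have := norm_add_le (F x - F₀) F₀
      rw [sub_add_cancel] at this
      linarith
    have hsq : (|z.im| ^ 3 * D) ^ 2 ≤ (1 + T) ^ 2 * (2 * ‖F x - F₀‖ ^ 2 + 18) := by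
      calc _ ≤ ((1 + T) * (‖F x - F₀‖ + 3)) ^ 2 := by
            exact pow_le_pow_left₀ (by positivity) (hFx.trans (by gcongr)) 2
        _ = (1 + T) ^ 2 * (‖F x - F₀‖ + 3) ^ 2 := by ring
        _ ≤ _ := by
          gcongr
          nlinarith [sq_nonneg (‖F x - F₀‖ - 3)]
    have hnorm : ‖F x - F₀‖ ^ 2 = (F x - F₀).re ^ 2 + (F x - F₀).im ^ 2 := by
      rw [Complex.sq_norm, Complex.normSq_apply]
      ring
    set a := (F x - F₀).re
    set b := (F x - F₀).im
    have hexp : u * (|z.im| ^ 3 * D) ^ 2 ≤ 1 + (c * a ^ 2 + c * b ^ 2) / 2 := by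
      calc _ ≤ u * ((1 + T) ^ 2 * (2 * ‖F x - F₀‖ ^ 2 + 18)) := by gcongr
        _ = 18 * (1 + T) ^ 2 * u + 4 * (1 + T) ^ 2 * u * (a ^ 2 + b ^ 2) / 2 := by
          rw [hnorm]
          ring
        _ ≤ 1 + c * (a ^ 2 + b ^ 2) / 2 := by gcongr
        _ = _ := by ring
    calc _ ≤ Real.exp (1 + (c * a ^ 2 + c * b ^ 2) / 2) := Real.exp_le_exp.2 hexp
      _ = Real.exp 1 * Real.exp ((c * a ^ 2 + c * b ^ 2) / 2) := Real.exp_add _ _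
      _ ≤ Real.exp 1 * ((Real.exp (c * a ^ 2) + Real.exp (c * b ^ 2)) / 2) := by
        gcongr
        exact exp_half_add_le _ _
      _ = _ := by ring
  -- Here `1 ≤ T` forces `N ≤ ‖x‖`, so the crude bound is linear in `‖x‖`. A positive multiple of
  -- `‖x‖² - T N²` is then added to the exponent, as in a Chernoff bound.
  · refine le_add_of_nonneg_of_le (by positivity) (Real.exp_le_exp.2 ?_)
    have hNx : N ≤ ‖x‖ := by
      refine (pow_le_pow_iff_left₀ hN0.le (norm_nonneg _) two_ne_zero).1 ?_
      nlinarith [sq_nonneg N]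
    have h1 : |z.im| ^ 3 * D ≤ (1 + K) * ‖x‖ := by
      calc _ ≤ |z.im| ^ 3 * (|z.im|⁻¹ * ‖x‖ + K * N * |z.im|⁻¹ ^ 2) := by gcongr
        _ = |z.im| ^ 2 * ‖x‖ + |z.im| * (K * N) := by field_simp
        _ ≤ 1 * ‖x‖ + 1 * (K * ‖x‖) := by
          gcongr
          exact pow_le_one₀ hη.le hz1
        _ = _ := by ring
    calc _ ≤ u * ((1 + K) * ‖x‖) ^ 2 := by gcongr
      _ = u * (1 + K) ^ 2 * ‖x‖ ^ 2 := by ring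
      _ ≤ _ := by
        have : 0 ≤ u * (1 + K) ^ 2 * (‖x‖ ^ 2 - T * N ^ 2) :=
          mul_nonneg (by positivity) (by linarith)
        linarith

theorem lintegral_exp_sq_norm_discrepancy_le {z : ℂ} (hz : z.im ≠ 0) (hz1 : |z.im| ≤ 1)
    (A : Matrix p q ℝ) {s K : ℝ} (hs : 0 ≤ s) (hsN : s ^ 2 * Fintype.card p = 1)
    (hK : (Fintype.card q : ℝ) ≤ K * Fintype.card p) (hK0 : 0 ≤ K) :
    ∫⁻ x, ENNReal.ofReal (Real.exp ((|z.im| ^ 3 * ‖discrepancy z A s x‖) ^ 2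
        / (16 * (7 + 6 * K) * (2 + 4 * K)) ^ 2)) ∂(stdGaussian (EuclideanSpace ℝ (p × q))) ≤ 2 := by
  set γ := stdGaussian (EuclideanSpace ℝ (p × q))
  have hη := abs_pos.2 hz
  have hη3 : |z.im| ^ 3 * |z.im|⁻¹ ^ 3 = 1 := by
    rw [← mul_pow, mul_inv_cancel₀ hη.ne', one_pow]
  set L : ℝ := 7 + 6 * K with hL
  have hL0 : 0 < L := by positivity
  have hKL : 1 + K ≤ L := by linarith
  -- The chi-square moment costs at most `exp (4 w K N²)`; `T > 4K` makes `exp (-w T N²)` outweigh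
  -- it, and `T ≥ 1` is needed for the splitting.
  set T : ℝ := 1 + 4 * K with hT
  have hT1 : 1 ≤ T := by linarith
  have hT2 : 2 + 4 * K = 1 + T := by rw [hT]; ring
  rw [hT2]
  -- The numerator `6` is the divisor given up in `exp_div_six_le`.
  set u : ℝ := 6 / (16 * L * (1 + T)) ^ 2 with hu
  have hu0 : 0 ≤ u := by positivity
  -- Since `π² < 10`, this gives `c (π/2)² L² ≤ 1/4`, as concentration requires.
  set c : ℝ := 1 / (10 * L ^ 2) with hc
  have huc : 4 * (1 + T) ^ 2 * u ≤ c := by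
    have : 4 * (1 + T) ^ 2 * u = 24 / 256 * (1 / L ^ 2) := by
      rw [hu]
      field_simp
      norm_num
    rw [this, show c = 1 / 10 * (1 / L ^ 2) by rw [hc]; field_simp]
    exact mul_le_mul_of_nonneg_right (by norm_num) (by positivity)
  have hL1 : 1 ≤ L := by linarith
  have hcL : c * L ^ 2 = 1 / 10 := by
    rw [hc]
    field_simp
  have hcle : c ≤ 1 / 10 := by
    rw [← hcL]
    exact le_mul_of_one_le_right (by positivity) (one_le_pow₀ hL1)
  have hu1 : 18 * (1 + T) ^ 2 * u ≤ 1 := by linarith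
  obtain ⟨F, hF⟩ : ∃ F : EuclideanSpace ℝ (p × q) → ℂ, ∀ x, F x = ((|z.im| : ℝ) : ℂ) ^ 3 *
      ((damping (Fintype.card p) x : ℂ) * discrepancy z A s x) := ⟨_, fun _ => rfl⟩
  have hFfun : F = fun x => ((|z.im| : ℝ) : ℂ) ^ 3 *
      ((damping (Fintype.card p) x : ℂ) * discrepancy z A s x) := funext hF
  have hsmooth := contDiff_damping_mul (contDiff_discrepancy hz A s) (Fintype.card p)
  have hFc : ContDiff ℝ 1 F := by
    rw [hFfun]
    exact contDiff_const.mul hsmooth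
  have hFL : ∀ x, ‖fderiv ℝ F x‖ ≤ L := fun x => by
    rw [hFfun, fderiv_const_mul (hsmooth.differentiable one_ne_zero x), norm_smul, norm_pow,
      Complex.norm_real, Real.norm_of_nonneg hη.le]
    calc _ ≤ |z.im| ^ 3 * (L * |z.im|⁻¹ ^ 3) := by
          gcongr
          exact norm_fderiv_damping_mul_discrepancy_le A hz hz1 hs hsN hK hK0 x
      _ = L * (|z.im| ^ 3 * |z.im|⁻¹ ^ 3) := by ring
      _ = L := by rw [hη3, mul_one]
  have hFB : ∀ x, ‖F x‖ ≤ |z.im| ^ 3 *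
      (|z.im|⁻¹ * Fintype.card p + K * Fintype.card p * |z.im|⁻¹ ^ 2) := fun x => by
    rw [hF, norm_mul, norm_pow, Complex.norm_real, Real.norm_of_nonneg hη.le]
    gcongr
    exact norm_damping_mul_discrepancy_le A hz hs hsN hK hK0 x
  have hF₀ : ‖∫ x, F x ∂γ‖ ≤ 3 := by
    rw [hFfun, integral_const_mul, norm_mul, norm_pow, Complex.norm_real,
      Real.norm_of_nonneg hη.le]
    calc _ ≤ |z.im| ^ 3 * (3 * |z.im|⁻¹ ^ 3) := by
          gcongr
          exact norm_integral_damping_mul_discrepancy_le A hz hz1 hs hsN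
      _ = 3 * (|z.im| ^ 3 * |z.im|⁻¹ ^ 3) := by ring
      _ = 3 := by rw [hη3, mul_one]
  obtain ⟨hre, him⟩ := lintegral_exp_sq_re_sub_integral_le hFc hFL hFB (c := c) (by positivity) (by
    calc c * (Real.pi / 2) ^ 2 * L ^ 2 = (c * L ^ 2) * (Real.pi ^ 2 / 4) := by ring
      _ ≤ 1 / 10 * (10 / 4) := by
        rw [hcL]
        gcongr
        nlinarith [Real.pi_lt_d2, Real.pi_pos]
      _ = 1 / 4 := by norm_num)
  set F₀ := ∫ x, F x ∂γ
  set N : ℝ := (Fintype.card p : ℝ) with hN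
  set w : ℝ := u * (1 + K) ^ 2 with hw
  have hw0 : 0 ≤ w := by positivity
  have hw1 : 2 * w ≤ 1 / 4 := by
    have h1 : w ≤ u * L ^ 2 := by rw [hw]; gcongr
    have h2 : u * L ^ 2 * (4 * (1 + T) ^ 2) ≤ 1 / 10 := by
      calc _ = 4 * (1 + T) ^ 2 * u * L ^ 2 := by ring
        _ ≤ c * L ^ 2 := by gcongr
        _ = _ := hcL
    have h3 : u * L ^ 2 * 1 ≤ u * L ^ 2 * (4 * (1 + T) ^ 2) := by
      gcongr
      nlinarith
    linarith
  have hchi : ∫⁻ x, ENNReal.ofReal (Real.exp (2 * w * ‖x‖ ^ 2 - w * (T * N ^ 2))) ∂γ ≤ 1 := by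
    have h1 : ∀ x : EuclideanSpace ℝ (p × q),
        ENNReal.ofReal (Real.exp (2 * w * ‖x‖ ^ 2 - w * (T * N ^ 2)))
          = ENNReal.ofReal (Real.exp (-(w * (T * N ^ 2))))
            * ENNReal.ofReal (Real.exp (2 * w * ‖x‖ ^ 2)) := fun x => by
      rw [← ENNReal.ofReal_mul (Real.exp_pos _).le, ← Real.exp_add]
      ring_nf
    simp_rw [h1]
    rw [lintegral_const_mul _ (by fun_prop)]
    refine (mul_le_mul_right (lintegral_exp_mul_norm_sq_stdGaussian_le (by positivity) hw1) _).trans ?_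
    rw [← ENNReal.ofReal_mul (Real.exp_pos _).le, ← Real.exp_add]
    refine ENNReal.ofReal_le_one.2 (Real.exp_le_one_iff.2 ?_)
    rw [Fintype.card_prod]
    push_cast
    rw [← hN]
    have h2 : N * (Fintype.card q : ℝ) ≤ N * (K * N) := by gcongr
    have h3 : 0 ≤ w * (N * (K * N) - N * Fintype.card q) := mul_nonneg hw0 (by linarith)
    have h4 : 0 ≤ w * N ^ 2 := by positivity
    rw [hT]
    nlinarith
  have hmF := hFc.continuous.measurable
  have hpt : ∀ x, ENNReal.ofReal (Real.exp ((|z.im| ^ 3 * ‖discrepancy z A s x‖) ^ 2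
        / (16 * L * (1 + T)) ^ 2))
      ≤ ENNReal.ofReal (5 / 6) + ENNReal.ofReal (1 / 6) * (ENNReal.ofReal (3 / 2) *
        (ENNReal.ofReal (Real.exp (c * (F x - F₀).re ^ 2))
          + ENNReal.ofReal (Real.exp (c * (F x - F₀).im ^ 2)))
        + ENNReal.ofReal (Real.exp (2 * w * ‖x‖ ^ 2 - w * (T * N ^ 2)))) := fun x => by
    rw [← ENNReal.ofReal_add (Real.exp_pos _).le (Real.exp_pos _).le,
      ← ENNReal.ofReal_mul (by norm_num), ← ENNReal.ofReal_add (by positivity) (Real.exp_pos _).le,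
      ← ENNReal.ofReal_mul (by norm_num), ← ENNReal.ofReal_add (by norm_num) (by positivity)]
    apply ENNReal.ofReal_le_ofReal
    have h1 := exp_sq_norm_discrepancy_le hz hz1 A hs hsN hK hK0 hT1 hu0 hF hF₀ huc hu1 x
    have h2 := exp_div_six_le (u * (|z.im| ^ 3 * ‖discrepancy z A s x‖) ^ 2)
    have h3 : (|z.im| ^ 3 * ‖discrepancy z A s x‖) ^ 2 / (16 * L * (1 + T)) ^ 2
        = u * (|z.im| ^ 3 * ‖discrepancy z A s x‖) ^ 2 / 6 := by
      rw [hu]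
      ring
    rw [h3]
    refine h2.trans ?_
    have h4 : Real.exp 1 / 2 *
          (Real.exp (c * (F x - F₀).re ^ 2) + Real.exp (c * (F x - F₀).im ^ 2))
        ≤ 3 / 2 * (Real.exp (c * (F x - F₀).re ^ 2) + Real.exp (c * (F x - F₀).im ^ 2)) := by
      gcongr
      linarith [Real.exp_one_lt_d9]
    linarith
  refine (lintegral_mono hpt).trans ?_
  rw [lintegral_add_left (by fun_prop), lintegral_const_mul _ (by fun_prop),
    lintegral_add_left (by fun_prop), lintegral_const_mul _ (by fun_prop),
    lintegral_add_left (by fun_prop), lintegral_const, measure_univ, mul_one]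
  -- The real and imaginary parts contribute `2` each and the tail `1`. With `e / 2 ≤ 3/2` the total
  -- inside is `7`.
  calc _ ≤ ENNReal.ofReal (5 / 6) + ENNReal.ofReal (1 / 6) *
        (ENNReal.ofReal (3 / 2) * (2 + 2) + 1) := by gcongr
    _ = ENNReal.ofReal (5 / 6 + 1 / 6 * (3 / 2 * (2 + 2) + 1)) := by
      rw [ENNReal.ofReal_add (by norm_num) (by norm_num), ENNReal.ofReal_mul (by norm_num),
        ENNReal.ofReal_add (by norm_num) (by norm_num), ENNReal.ofReal_mul (by norm_num),
        ENNReal.ofReal_add (by norm_num) (by norm_num)]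
      simp
    _ = 2 := by norm_num

end SubGaussian

/-! ### The exact trace identity. -/

section TraceRelation

variable {N M : ℕ}

theorem toComplex_mul_transpose (A B : Matrix (Fin N) (Fin M) ℝ) :
    toComplex (A * B.transpose) = toComplex A * (toComplex B).transpose := by
  ext i j
  simp [toComplex, Matrix.mul_apply]

theorem linearization_eq (Y : Matrix (Fin N) (Fin M) ℝ) :
    linearization Y = Matrix.fromBlocks 0 (toComplex Y) (toComplex Y).transpose 0 := rfl

/-- The blocks of the resolvent of the linearization. -/
theorem blocks_inv_linearization (Y : Matrix (Fin N) (Fin M) ℝ) {z : ℂ} (hz : z.im ≠ 0)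
    {R : Matrix (Fin N ⊕ Fin M) (Fin N ⊕ Fin M) ℂ} (hR : R = (z • 1 - linearization Y)⁻¹) :
    R.toBlocks₁₁ = z • resolventYYT Y (z ^ 2) ∧
    R.toBlocks₁₂ = resolventYYT Y (z ^ 2) * toComplex Y ∧
    z * R.toBlocks₂₂.trace = z * R.toBlocks₁₁.trace + M - N ∧
    z ^ 2 * (resolventYYT Y (z ^ 2)).trace
      - (resolventYYT Y (z ^ 2) * toComplex Y * (toComplex Y).transpose).trace = N := by
  have hz0 : z ≠ 0 := fun h => hz (by simp [h])
  have hu := (Matrix.isUnit_iff_isUnit_det _).1 ((isHermitian_linearization Y).isUnit_smul_one_sub hz)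
  have hl : R * (z • 1 - linearization Y) = 1 := hR ▸ Matrix.nonsing_inv_mul _ hu
  have hr : (z • 1 - linearization Y) * R = 1 := hR ▸ Matrix.mul_nonsing_inv _ hu
  clear hR
  obtain ⟨R₁₁, R₁₂, R₂₁, R₂₂, rfl⟩ : ∃ a b c d, R = Matrix.fromBlocks a b c d :=
    ⟨_, _, _, _, (Matrix.fromBlocks_toBlocks R).symm⟩
  have hM : z • (1 : Matrix (Fin N ⊕ Fin M) (Fin N ⊕ Fin M) ℂ) - linearization Y
      = Matrix.fromBlocks (z • 1) (-toComplex Y) (-(toComplex Y).transpose) (z • 1) := by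
    rw [linearization_eq, ← Matrix.fromBlocks_one, Matrix.fromBlocks_smul, sub_eq_add_neg,
      Matrix.fromBlocks_neg, Matrix.fromBlocks_add]
    simp
  rw [hM, Matrix.fromBlocks_multiply, ← Matrix.fromBlocks_one, Matrix.fromBlocks_inj] at hl hr
  obtain ⟨h1, h2, -, -⟩ := hl
  obtain ⟨-, -, -, h3⟩ := hr
  simp only [Matrix.mul_smul, Matrix.smul_mul, mul_one, Matrix.mul_one, one_mul,
    Matrix.mul_neg, Matrix.neg_mul] at h1 h2 h3
  simp only [Matrix.toBlocks_fromBlocks₁₁, Matrix.toBlocks_fromBlocks₁₂,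
    Matrix.toBlocks_fromBlocks₂₂]
  set Yc := toComplex Y
  have h2' : z • R₁₂ = R₁₁ * Yc := eq_of_sub_eq_zero (by rw [← h2]; abel)
  have hinv : z⁻¹ • R₁₁ = resolventYYT Y (z ^ 2) := by
    refine (Matrix.inv_eq_left_inv ?_).symm
    rw [toComplex_mul_transpose, Matrix.smul_mul, mul_sub, Matrix.mul_smul, mul_one,
      ← Matrix.mul_assoc, ← h2', Matrix.smul_mul, ← h1, sq, smul_sub, smul_smul, smul_smul,
      inv_mul_cancel_left₀ hz0, inv_mul_cancel₀ hz0, one_smul, sub_eq_add_neg]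
  have h11 : R₁₁ = z • resolventYYT Y (z ^ 2) := by
    rw [← hinv, smul_smul, mul_inv_cancel₀ hz0, one_smul]
  have h12 : R₁₂ = resolventYYT Y (z ^ 2) * Yc := by
    rw [← hinv, Matrix.smul_mul, ← h2', smul_smul, inv_mul_cancel₀ hz0, one_smul]
  have t1 := congrArg Matrix.trace h1
  have t3 := congrArg Matrix.trace h3
  simp only [Matrix.trace_add, Matrix.trace_neg, Matrix.trace_smul, Matrix.trace_one,
    Fintype.card_fin, smul_eq_mul] at t1 t3
  rw [Matrix.trace_mul_comm Yc.transpose] at t3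
  -- Cyclicity identifies the off-diagonal traces in the two diagonal block equations, so
  -- subtracting leaves only the dimensions `M - N`.
  refine ⟨h11, h12, by linear_combination t3 - t1, ?_⟩
  rw [← h12, ← t1, h11, Matrix.trace_smul, smul_eq_mul]
  ring

/-- The trace of `Q Y Yᵀ` is known from the resolvent identity. Splitting the last factor into
signal and noise expresses `L` through `G` and `∑ R_ij x_ij`. -/
theorem traceL_sub_eq (hN : 0 < N) (hM : 0 < M) {lam : ℝ} (hlam : 0 < lam)
    (S : Matrix (Fin N) (Fin M) ℝ) {s : ℝ} (hs : s ^ 2 * N = 1)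
    (x : EuclideanSpace ℝ (Fin N × Fin M)) {z : ℂ} (hz : z.im ≠ 0) :
    traceL (observation lam S (scaledMatrix s x)) S z
      - (1 / (Real.sqrt lam : ℂ)) *
        (traceG (observation lam S (scaledMatrix s x)) z
            * (z ^ 2 + 1 - 1 / (((N : ℝ) / (M : ℝ) : ℝ) : ℂ))
          - z ^ 2 * traceG (observation lam S (scaledMatrix s x)) z ^ 2 - 1)
      = -(1 / (Real.sqrt lam : ℂ)) * (discrepancy z (Real.sqrt lam • S) s x / N) := by
  set Y := observation lam S (scaledMatrix s x) with hY
  obtain ⟨R, hR⟩ : ∃ R, R = (z • 1 - linearization Y)⁻¹ := ⟨_, rfl⟩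
  obtain ⟨h11, h12, h22, hY2⟩ := blocks_inv_linearization Y hz hR
  have hz0 : z ≠ 0 := fun h => hz (by simp [h])
  have hNc : (N : ℂ) ≠ 0 := by exact_mod_cast hN.ne'
  have hMc : (M : ℂ) ≠ 0 := by exact_mod_cast hM.ne'
  have hlc : (Real.sqrt lam : ℂ) ≠ 0 := by exact_mod_cast (Real.sqrt_pos.2 hlam).ne'
  have hsc : (s : ℂ) ^ 2 * N = 1 := by exact_mod_cast hs
  set Q := resolventYYT Y (z ^ 2) with hQ
  have hRdisc : linRes z (Real.sqrt lam • S) s x = R := hR.symm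
  have hsplit : (Q * toComplex Y * (toComplex Y).transpose).trace
      = Real.sqrt lam * (Q * toComplex Y * toComplex S.transpose).trace
        + s * ∑ i, ∑ j, R (.inl i) (.inr j) * (x (i, j) : ℂ) := by
    have hYt : (toComplex Y).transpose = (Real.sqrt lam : ℂ) • toComplex S.transpose
        + (toComplex (scaledMatrix s x)).transpose := by
      ext i j
      simp [hY, observation, toComplex]
    rw [hYt, Matrix.mul_add, Matrix.trace_add, Matrix.mul_smul, Matrix.trace_smul, smul_eq_mul, ← h12]
    congr 1
    simp only [Matrix.trace, Matrix.diag_apply, Matrix.mul_apply, Matrix.toBlocks₁₂,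
      Matrix.of_apply, Matrix.transpose_apply, toComplex, Matrix.map_apply, scaledMatrix,
      Finset.mul_sum]
    refine Finset.sum_congr rfl fun i _ => Finset.sum_congr rfl fun j _ => ?_
    push_cast
    ring
  have ht1 : ∑ i, R (.inl i) (.inl i) = z * Q.trace := by
    have := congrArg Matrix.trace h11
    rw [Matrix.trace_smul, smul_eq_mul] at this
    exact this
  have ht2 : z * ∑ j, R (.inr j) (.inr j) = z * (z * Q.trace) + M - N := by
    rw [h11, Matrix.trace_smul, smul_eq_mul] at h22
    exact h22
  unfold discrepancy
  rw [hRdisc, ht1]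
  have hL : traceL Y S z = 1 / N * (Q * toComplex Y * toComplex S.transpose).trace := rfl
  have hG : traceG Y z = 1 / N * Q.trace := rfl
  rw [hL, hG]
  rw [hsplit] at hY2
  set τ := Q.trace
  set ℓ := (Q * toComplex Y * toComplex S.transpose).trace
  set w := ∑ i, ∑ j, R (.inl i) (.inr j) * (x (i, j) : ℂ)
  set t := ∑ j, R (.inr j) (.inr j)
  -- Eliminating `Tr R₂₂` produces both the quadratic term `z² G²` and the `1 - 1/α₀` in the linear
  -- one.
  have hprod : z * τ * t = τ * (z * (z * τ) + M - N) := by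
    rw [← ht2]
    ring
  rw [hprod]
  have hs2 : (s : ℂ) ^ 2 = 1 / N := by
    rw [eq_div_iff hNc, hsc]
  rw [hs2]
  have hsw : s * w = z ^ 2 * τ - N - Real.sqrt lam * ℓ := by linear_combination -hY2
  rw [hsw]
  push_cast
  field_simp
  ring

end TraceRelation

/-! ### Transfer to the given noise matrix and conclusion. -/

section MainTheorem

theorem map_toLp_stdGaussian_of_isGaussianNoise {Ω : Type*} [MeasurableSpace Ω] {P : Measure Ω}
    {N M : ℕ} (hN : 0 < N) {Z : Ω → Matrix (Fin N) (Fin M) ℝ} (hZ : IsGaussianNoise P Z) :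
    P.map (fun ω => WithLp.toLp 2 fun k : Fin N × Fin M => √(N : ℝ) * Z ω k.1 k.2)
      = stdGaussian (EuclideanSpace ℝ (Fin N × Fin M)) := by
  have hmeas : ∀ k : Fin N × Fin M, Measurable fun ω => √(N : ℝ) * Z ω k.1 k.2 := fun k =>
    (hZ.measurable_entry k.1 k.2).const_mul _
  have hind : iIndepFun (fun (k : Fin N × Fin M) ω => √(N : ℝ) * Z ω k.1 k.2) P :=
    hZ.indep_entries.comp (fun _ t => √(N : ℝ) * t) fun _ => measurable_const_mul _
  have hpi := hind.map_fun_eq_pi_map fun k => (hmeas k).aemeasurable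
  have hlaw : ∀ k : Fin N × Fin M, P.map (fun ω => √(N : ℝ) * Z ω k.1 k.2) = gaussianReal 0 1 := by
    intro k
    have h1 := Measure.map_map (μ := P) (measurable_const_mul √(N : ℝ))
      (hZ.measurable_entry k.1 k.2)
    rw [hZ.law_entry, gaussianReal_map_const_mul] at h1
    have h2 : P.map (fun ω => √(N : ℝ) * Z ω k.1 k.2)
        = P.map ((√(N : ℝ) * ·) ∘ fun ω => Z ω k.1 k.2) := rfl
    rw [h2, ← h1]
    congr 1
    · simp
    · ext
      have : (N : ℝ) ≠ 0 := by exact_mod_cast hN.ne'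
      simp [this]
  simp_rw [hlaw] at hpi
  rw [← map_pi_eq_stdGaussian, ← hpi, Measure.map_map (by fun_prop) (measurable_pi_lambda _ hmeas)]
  rfl

end MainTheorem

theorem theorem2 (K : ℝ) (hK : 0 < K) :
    ∃ (C : ℝ) (κ : ℝ≥0), 0 < C ∧
      ∀ (N M : ℕ), 0 < N → 0 < M → (M : ℝ) / (N : ℝ) ≤ K →
      ∀ (lam : ℝ), 0 < lam →
      ∀ (S : Matrix (Fin N) (Fin M) ℝ), opNorm S ≤ K →
      ∀ (Ω : Type u) [MeasurableSpace Ω] (P : Measure Ω) [IsProbabilityMeasure P]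
        (Z : Ω → Matrix (Fin N) (Fin M) ℝ), IsGaussianNoise P Z →
      ∀ (α₀ : ℝ), α₀ = (N : ℝ) / (M : ℝ) →
      ∀ (z : ℂ), z.im ≠ 0 → |z.im| < 1 →
      ∃ (ε X : Ω → ℂ), Measurable X ∧ subGaussianNorm P X ≤ (κ : ℝ≥0∞) ∧
        ∀ ω : Ω,
          traceL (observation lam S (Z ω)) S z
            = (1 / (Real.sqrt lam : ℂ)) *
                (traceG (observation lam S (Z ω)) z * (z ^ 2 + 1 - 1 / (α₀ : ℂ))
                  - z ^ 2 * traceG (observation lam S (Z ω)) z ^ 2 - 1)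
              + ε ω ∧
          ‖ε ω‖ ≤ (1 + 1 / Real.sqrt lam) * (‖(C : ℂ) + X ω‖ / ((N : ℝ) * |z.im| ^ 3)) := by
  -- The mean of the discrepancy is already absorbed in `X`, so any positive constant serves as `C`.
  refine ⟨1, Real.toNNReal (16 * (7 + 6 * K) * (2 + 4 * K)), one_pos, ?_⟩
  intro N M hN hM hMN lam hlam S _ Ω _ P _ Z hZ α₀ hα z hz hz1
  subst hα
  have hη := abs_pos.2 hz
  have hN0 : (0 : ℝ) < N := by exact_mod_cast hN
  set s : ℝ := (√(N : ℝ))⁻¹ with hs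
  have hs0 : 0 ≤ s := by positivity
  have hsN : s ^ 2 * (N : ℝ) = 1 := by
    rw [hs, inv_pow, Real.sq_sqrt hN0.le, inv_mul_cancel₀ hN0.ne']
  let x : Ω → EuclideanSpace ℝ (Fin N × Fin M) := fun ω =>
    WithLp.toLp 2 fun k => √(N : ℝ) * Z ω k.1 k.2
  have hxZ : ∀ ω, scaledMatrix s (x ω) = Z ω := fun ω => by
    ext i j
    simp only [scaledMatrix, x, Matrix.of_apply]
    rw [← mul_assoc, hs, inv_mul_cancel₀ (by positivity), one_mul]
  have hxm : Measurable x := (WithLp.measurable_toLp 2 _).comp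
    (measurable_pi_lambda _ fun k => (hZ.measurable_entry k.1 k.2).const_mul _)
  have hlaw : P.map x = stdGaussian (EuclideanSpace ℝ (Fin N × Fin M)) :=
    map_toLp_stdGaussian_of_isGaussianNoise hN hZ
  have hDm : Measurable (discrepancy z (Real.sqrt lam • S) s) :=
    (contDiff_discrepancy hz _ s).continuous.measurable
  -- `X` is taken real and nonnegative, so `‖1 + X‖ = 1 + X` dominates `X` without cancellation.
  let W : Ω → ℝ := fun ω => |z.im| ^ 3 * ‖discrepancy z (Real.sqrt lam • S) s (x ω)‖
  have hWm : Measurable W := ((hDm.comp hxm).norm).const_mul _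
  have hW0 : ∀ ω, 0 ≤ W ω := fun ω => by positivity
  refine ⟨fun ω => -(1 / (Real.sqrt lam : ℂ)) *
    (discrepancy z (Real.sqrt lam • S) s (x ω) / N), fun ω => (W ω : ℂ),
    Complex.measurable_ofReal.comp hWm, ?_, fun ω => ⟨?_, ?_⟩⟩
  · refine iInf_le_of_le _ (iInf_le_of_le ?_ (iInf_le_of_le ?_ le_rfl))
    · exact Real.toNNReal_pos.2 (by positivity)
    · have h := lintegral_exp_sq_norm_discrepancy_le hz hz1.le (Real.sqrt lam • S) hs0
        (by simpa using hsN) (K := K) (by simpa using (div_le_iff₀ hN0).1 hMN) hK.le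
      rw [← hlaw, lintegral_map (by have := hDm.norm; fun_prop) hxm] at h
      have hκ : 0 ≤ 16 * (7 + 6 * K) * (2 + 4 * K) := by positivity
      simpa only [W, Complex.norm_real, Real.norm_of_nonneg (hW0 _), Real.coe_toNNReal _ hκ] using h
  · rw [add_comm, ← sub_eq_iff_eq_add]
    have h := traceL_sub_eq hN hM hlam S hsN (x ω) hz
    rw [hxZ] at h
    exact h
  · have h1 : ‖((1 : ℝ) : ℂ) + (W ω : ℂ)‖ = 1 + W ω := by
      rw [← Complex.ofReal_add, Complex.norm_real, Real.norm_of_nonneg (by linarith [hW0 ω])]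
    have hsl := Real.sqrt_pos.2 hlam
    rw [h1, norm_mul, norm_neg, norm_div, norm_div, norm_one, Complex.norm_real,
      Complex.norm_natCast, Real.norm_of_nonneg hsl.le]
    have h2 : ‖discrepancy z (Real.sqrt lam • S) s (x ω)‖ / N = W ω / (N * |z.im| ^ 3) := by
      simp only [W]
      field_simp
    rw [h2]
    gcongr
    · linarith
    · linarith
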